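/- **Setting.** An input of the Covering Canadian Traveller Problem consists of a complete graph on a finite vertex set $V$ with non-negative symmetric edge costs $d$ that satisfy the triangle inequality, a source $s\in V$, and a set $B$ of blocked edges such that the graph $(V,\overline B)$ of the unblocked edges is connected. In $k$-CCTP, $|B|\le k$. The traveller knows $V,d,s$, starts at $s$, moves along unblocked edges, and upon reaching a vertex learns which of its incident edges are blocked; all vertices have to be visited and the traveller has to return to $s$. A deterministic online algorithm determines each move (or that it stops) from what has been seen so far. It is $c$-competitive for $k$-CCTP if, for every admissible $B$ with $|B|\le k$, it stops after such a tour, of cost at most $c$ times the minimum cost of a tour when $B$ is known. **The algorithm CNN.** 1. *Christofides.* Take a minimum spanning tree $T$, a minimum-weight perfect matching $M$ on the vertices of odd degree in $T$, and an Eulerian cycle of the multigraph $T+M$; skip repeated vertices to get a Hamiltonian cycle $s=v_1\to v_2\to\dots\to v_n\to v_1$. 2. *ShortCut.* From $s$, try to go to $v_2,\dots,v_n$ in this order, skipping $v_j$ if the edge from the current vertex to $v_j$ is blocked. Then return to $s$, directly if that edge is unblocked and otherwise by retracing all steps. 3. *Compress.* Let $U_s$ consist of $s$ and the vertices not yet visited.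 Form the multigraph $G'$ on $U_s$ which has, between distinct $x,y\in U_s$, the edge $\{x,y\}$ (of unknown state unless $s \in \{x,y\}$) and, if one exists, an edge representing a shortest path from $x$ to $y$ that uses only unblocked edges with at least one endpoint outside $U_s$, with the cost of that path. 4. *Nearest Neighbor on $G'$.* As long as some vertex of $G'$ is unexplored, go to an unexplored vertex that is cheapest to reach from the current vertex along edges of $G'$ known to be passable; finally return to $s$ along a cheapest way. Edges that represent paths are expanded into these paths. Ties may be broken in any way, and CNN does not need to know $k$. **Corollary (CNN has competitive ratio $O(\log k)$).** There is an absolute constant $C>0$ such that, for every finite complete metric graph $(V,d)$ and every source $s\in V$: CNN can be carried out as a deterministic online algorithm, and every deterministic online algorithm that implements CNN is $(C\log k)$-competitive for $k$-CCTP, for every integer $k\ge 2$. -/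

import Mathlib

noncomputable section

namespace CCTP

open Classical

/-! ### Walks, tours and costs

A complete metric graph is a finite vertex type `V` whose edge costs are given by the distance
of a pseudometric (non-negative, symmetric, triangle inequality; distinct vertices may have
distance zero). Walks are written as the list of the vertices they go through. -/

section Walks

variable {V : Type*}

/-- `p` lists the vertices of a walk from `x` to `y` in the graph `G`. -/
def IsWalk (G : SimpleGraph V) (x y : V) (p : List V) : Prop :=
  p.head? = some x ∧ p.getLast? = some y ∧ p.IsChain G.Adj

/-- `p` lists the vertices of a (simple) path from `x` to `y` in the graph `G`. -/
def IsPath (G : SimpleGraph V) (x y : V) (p : List V) : Prop :=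
  IsWalk G x y p ∧ p.Nodup

/-- The list of the edges between consecutive entries of `p`, with repetitions. -/
def walkEdges (p : List V) : List (Sym2 V) :=
  List.zipWith (fun x y => s(x, y)) p p.tail

variable [PseudoMetricSpace V]

/-- The total cost of the steps of `p`. -/
def walkCost (p : List V) : ℝ :=
  (List.zipWith dist p p.tail).sum

/-- `p` is a shortest path from `x` to `y` in `G`. -/
def IsShortestPath (G : SimpleGraph V) (x y : V) (p : List V) : Prop :=
  IsPath G x y p ∧ ∀ q, IsPath G x y q → walkCost p ≤ walkCost q

end Walks

/-! ### The Covering Canadian Traveller Problem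

The blocked edges form a graph `B` on `V`; the edges that can be traversed are those of `Bᶜ`. -/

section Problem

variable {V : Type*}

/-- A tour: a closed walk from `s` along unblocked edges that visits every vertex. -/
def IsTour (B : SimpleGraph V) (s : V) (w : List V) : Prop :=
  IsWalk Bᶜ s s w ∧ ∀ v, v ∈ w

/-- What the traveller has seen after walking along `w`: for every vertex on the way, that vertex
together with the set of those vertices to which its edge is blocked. -/
def history (B : SimpleGraph V) (w : List V) : List (V × Set V) :=
  w.map fun v => (v, B.neighborSet v)

/-- A deterministic online algorithm (for a given complete metric graph and source): from what has
been seen so far it determines the next vertex to go to, or it stops (`none`). -/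
abbrev OnlineAlgorithm (V : Type*) := List (V × Set V) → Option V

/-- The traveller who starts at `s` and follows `A` while the blocked edges are those of `B`
walks exactly along `w` and then stops. -/
def OnlineAlgorithm.Outputs (A : OnlineAlgorithm V) (B : SimpleGraph V) (s : V) (w : List V) :
    Prop :=
  w.head? = some s ∧ ∀ i, 0 < i → i ≤ w.length → A (history B (w.take i)) = w[i]?

/-- The cost of an optimal tour for a traveller who knows all blocked edges in advance. -/
def optCost [PseudoMetricSpace V] (B : SimpleGraph V) (s : V) : ℝ :=
  sInf {c | ∃ w, IsTour B s w ∧ walkCost w = c}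

/-- `A` is `c`-competitive for `k`-CCTP on the complete metric graph `V` with source `s`: if at
most `k` edges are blocked and the rest of the graph is connected, then `A` terminates with a tour
of cost at most `c` times the optimum. -/
def IsCompetitive [PseudoMetricSpace V] (s : V) (A : OnlineAlgorithm V) (k : ℕ) (c : ℝ) : Prop :=
  ∀ B : SimpleGraph V, Bᶜ.Connected → B.edgeSet.ncard ≤ k →
    ∃ w, A.Outputs B s w ∧ IsTour B s w ∧ walkCost w ≤ c * optCost B s

end Problem

/-! ### Christofides' algorithm -/

section Christofides

variable {V : Type*} [Finite V]

/-- The edges in `E` as a finite set. -/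
def edgesOf (E : Set (Sym2 V)) : Finset (Sym2 V) := E.toFinite.toFinset

variable [PseudoMetricSpace V]

/-- The cost of an edge. -/
def edgeCost (e : Sym2 V) : ℝ :=
  Sym2.lift ⟨fun x y : V => dist x y, fun x y => dist_comm x y⟩ e

/-- The total cost of a set of edges. -/
def edgeSetCost (E : Set (Sym2 V)) : ℝ := ∑ e ∈ edgesOf E, edgeCost e

/-- `T` is a minimum spanning tree of the complete graph on `V`. -/
def IsMinSpanningTree (T : SimpleGraph V) : Prop :=
  T.IsTree ∧ ∀ T' : SimpleGraph V, T'.IsTree → edgeSetCost T.edgeSet ≤ edgeSetCost T'.edgeSet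

/-- The vertices of odd degree. -/
def oddVertices (T : SimpleGraph V) : Set V := {v | Odd (T.neighborSet v).ncard}

/-- `M` is a minimum-weight perfect matching of the complete graph on the vertex set `O`. -/
def IsMinPerfectMatching (O : Set V) (M : (⊤ : SimpleGraph V).Subgraph) : Prop :=
  (M.IsMatching ∧ M.verts = O) ∧
    ∀ M' : (⊤ : SimpleGraph V).Subgraph, M'.IsMatching → M'.verts = O →
      edgeSetCost M.edgeSet ≤ edgeSetCost M'.edgeSet

/-- `w` is an Eulerian cycle, written from `s` to `s`, of the multigraph with the multiset of
edges `H`. -/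
def IsEulerianCycle (H : Multiset (Sym2 V)) (s : V) (w : List V) : Prop :=
  w.head? = some s ∧ w.getLast? = some s ∧ (walkEdges w : Multiset (Sym2 V)) = H

/-- `P = [v₁, …, vₙ]` with `v₁ = s` is a Hamiltonian cycle `v₁ → v₂ → ⋯ → vₙ → v₁` that
Christofides' algorithm may return: `T` is a minimum spanning tree, `M` a minimum-weight perfect
matching on the vertices of odd degree in `T`, `w` an Eulerian cycle of the multigraph that
combines `T` and `M`, and `P` keeps exactly one occurrence of every vertex on `w`. -/
def IsChristofidesTour (s : V) (P : List V) : Prop :=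
  ∃ (T : SimpleGraph V) (M : (⊤ : SimpleGraph V).Subgraph) (w : List V),
    IsMinSpanningTree T ∧
    IsMinPerfectMatching (oddVertices T) M ∧
    IsEulerianCycle ((edgesOf T.edgeSet).val + (edgesOf M.edgeSet).val) s w ∧
    P.Sublist w ∧ P.head? = some s ∧ P.Nodup ∧ ∀ v, v ∈ P

end Christofides

/-! ### Nearest Neighbor -/

section NearestNeighbor

variable {V : Type*}

/-- A multigraph all of whose edges stand for walks in the graph on `V`: `E x y p` says that `p` is
an edge from `x` to `y`. Its cost is `walkCost p`, and to take it means to walk along `p`. -/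
abbrev RouteGraph (V : Type*) := V → V → List V → Prop

/-- `Travel E S x y p`: the walk `p` from `x` to `y` is a concatenation of edges of `E`, each of
which starts at a vertex in `S`. When `S` is the set of explored vertices, these are the walks that
the searcher knows to be possible. -/
inductive Travel (E : RouteGraph V) (S : Set V) : V → V → List V → Prop
  | nil (x : V) : Travel E S x x [x]
  | cons {x y z : V} {p q : List V} :
      x ∈ S → E x y p → Travel E S y z q → Travel E S x z (p ++ q.tail)

/-- `NearestNeighbor E U s S c w`: when the vertices in `S` have been explored and the searcher is
at `c`, then `w` is a way in which Nearest Neighbor may complete the exploration of the vertex set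
`U` of the multigraph `E`. As long as there are unexplored vertices, it goes to one that is cheapest
to reach; at the end it returns to `s` along a cheapest way. -/
inductive NearestNeighbor [PseudoMetricSpace V] (E : RouteGraph V) (U : Set V) (s : V) :
    Set V → V → List V → Prop
  | done {S : Set V} {c : V} {p : List V} :
      U ⊆ S → Travel E S c s p →
      (∀ p', Travel E S c s p' → walkCost p ≤ walkCost p') →
      NearestNeighbor E U s S c p
  | visit {S : Set V} {c u : V} {p q : List V} :
      u ∈ U \ S → Travel E S c u p →
      (∀ u' ∈ U \ S, ∀ p', Travel E S c u' p' → walkCost p ≤ walkCost p') →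
      NearestNeighbor E U s (insert u S) u q →
      NearestNeighbor E U s S c (p ++ q.tail)

/-- `w` is a closed walk from `s` in which Nearest Neighbor may explore the multigraph `E` with
vertex set `U`. -/
def NearestNeighborRoute [PseudoMetricSpace V] (E : RouteGraph V) (U : Set V) (s : V)
    (w : List V) : Prop :=
  NearestNeighbor E U s {s} s w

end NearestNeighbor

/-! ### CompressAndExplore and CNN -/

section Algorithm

variable {V : Type*}

/-- The forward part of `ShortCut`: from `v`, try to go to the remaining vertices of the tour one
after the other, skipping a vertex if the edge to it from the current vertex is blocked. -/
def shortCutPath (B : SimpleGraph V) : V → List V → List V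
  | v, [] => [v]
  | v, u :: l => if B.Adj v u then shortCutPath B v l else v :: shortCutPath B u l

/-- `ShortCut`: follow the tour `P` from `s` with skipping; then go back to `s`, directly if the
edge is there, and by retracing all steps if it is blocked (if the traveller is still at `s`, this
means to stay there). -/
def shortCut (B : SimpleGraph V) (s : V) (P : List V) : List V :=
  let P' := shortCutPath B s P.tail
  if Bᶜ.Adj (P'.getLastD s) s then P' ++ [s] else P' ++ P'.reverse.tail

/-- The set `U_s` of `s` and the vertices that remain unvisited after `ShortCut`. -/
def remaining (B : SimpleGraph V) (s : V) (P : List V) : Set V :=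
  {v | v = s ∨ v ∉ shortCutPath B s P.tail}

/-- The graph of the unblocked edges that have at least one endpoint outside of `U`. -/
def knownGraph (B : SimpleGraph V) (U : Set V) : SimpleGraph V where
  Adj x y := Bᶜ.Adj x y ∧ (x ∉ U ∨ y ∉ U)
  symm := ⟨fun _ _ h => ⟨h.1.symm, h.2.symm⟩⟩
  loopless := ⟨fun _ h => h.1.ne rfl⟩

/-- `Compress`: the multigraph with vertex set `U` which has, between distinct vertices `x` and `y`,
the direct edge (it can be taken unless it is blocked) and an edge for a shortest path from `x` to
`y` in the known graph (if there is a path). -/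
def compress [PseudoMetricSpace V] (B : SimpleGraph V) (U : Set V) : RouteGraph V :=
  fun x y p => x ∈ U ∧ y ∈ U ∧ x ≠ y ∧
    ((¬ B.Adj x y ∧ p = [x, y]) ∨ IsShortestPath (knownGraph B U) x y p)

/-- `w` is a walk of `CompressAndExplore` if the blocked edges are those of `B`, the TSP routine has
returned the tour `P` and `explore E U s` holds for the closed walks from `s` in which the
exploration routine may explore a multigraph `E` with vertex set `U`. -/
def CompressAndExplore [PseudoMetricSpace V]
    (explore : RouteGraph V → Set V → V → List V → Prop)
    (B : SimpleGraph V) (s : V) (P w : List V) : Prop :=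
  ∃ q, explore (compress B (remaining B s P)) (remaining B s P) s q ∧
    w = shortCut B s P ++ q.tail

/-- `A` is an implementation of `CNN`, that is, of `CompressAndExplore` with Christofides' algorithm
and Nearest Neighbor: it computes some tour `P` by Christofides' algorithm, and whichever edges are
blocked, it terminates after a walk of `CompressAndExplore` for `P` and Nearest Neighbor. How ties
are broken is left open. -/
def IsCNN [Finite V] [PseudoMetricSpace V] (s : V) (A : OnlineAlgorithm V) : Prop :=
  ∃ P, IsChristofidesTour s P ∧
    ∀ B : SimpleGraph V, Bᶜ.Connected →
      ∃ w, A.Outputs B s w ∧ CompressAndExplore NearestNeighborRoute B s P w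

end Algorithm

end CCTP

end

/-!
Let `t` be any tour along unblocked edges and `W` its cost. All costs of CNN are compared with `W`.

*Christofides and ShortCut.* The edges of `t` contain a spanning tree, and matching the vertices of
odd degree in consecutive pairs, in the order in which `t` visits them, costs at most `W`. Hence the
Hamiltonian cycle, which skips vertices of an Eulerian cycle, costs at most `2 * W`
(`IsChristofidesTour.walkCost_le`), and `ShortCut` at most twice as much. Every vertex that is left
over has been skipped because of a blocked edge of its own, so at most `k` vertices are left over
(`ncard_remaining_le`).

*Nearest Neighbor.* An unblocked walk between vertices of the compressed graph can be followed there
at no additional cost until it first reaches an unexplored vertex (`exists_travel`). Therefore, if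
`ℓ x` is the cost of the step with which Nearest Neighbor leaves `x`, then `min (ℓ x) (ℓ y)` is at
most the distance of `x` and `y` in the unblocked graph. Place every vertex on the interval `[0, W]`
at the cost of `t` up to the first visit of that vertex: the places are at least as far apart as the
vertices (`IsWalk.exists_position`). So the `n` vertices with the largest values of `ℓ` are pairwise
at least the `n`-th largest value apart, which is then at most `2 * W / n`, and the sum of the steps
is at most `2 * W` times a harmonic number (`sum_le_harmonic`). The way back costs at most `W`.
Altogether CNN costs at most `(7 + 2 * log k) * W`, which is at most `13 * log k * W` for `k ≥ 2`.

*Existence.* The Eulerian cycle comes from Euler's theorem for multigraphs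
(`exists_isEulerianCycle`). Cheapest ways exist because the costs of walks form a well-ordered set
(`exists_min_walkCost`). Fixing one choice among them makes each step a function of what has been
seen, because the set of the ways known to be possible is such a function (`travel_congr`). Walks
with that property are the walks of one online algorithm (`exists_outputs`).
-/

noncomputable section

namespace CCTP

open Classical

/-! ### Walks and their costs -/

section WalkLemmas

variable {V : Type*} {G : SimpleGraph V} {x y z : V} {p q : List V}

lemma isWalk_singleton {a : V} : IsWalk G x y [a] ↔ a = x ∧ a = y := by
  simp [IsWalk]

lemma isWalk_cons_cons {a b : V} {l : List V} :
    IsWalk G x y (a :: b :: l) ↔ a = x ∧ G.Adj a b ∧ IsWalk G b y (b :: l) := by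
  simp [IsWalk, List.isChain_cons_cons]
  tauto

lemma IsWalk.ne_nil (h : IsWalk G x y p) : p ≠ [] := by
  rintro rfl; simp [IsWalk] at h

lemma IsWalk.eq_cons (h : IsWalk G x y p) : p = x :: p.tail := by
  cases p with
  | nil => simp [IsWalk] at h
  | cons a l => simpa [IsWalk] using h.1

lemma IsWalk.head_mem (h : IsWalk G x y p) : x ∈ p := by
  rw [h.eq_cons]; simp

lemma IsWalk.getLast_mem (h : IsWalk G x y p) : y ∈ p :=
  List.mem_of_getLast? h.2.1

lemma IsWalk.mem_tail_of_ne (h : IsWalk G x y p) (hne : x ≠ y) : y ∈ p.tail := by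
  have := h.getLast_mem
  rw [h.eq_cons] at this
  simpa [hne.symm] using this

theorem IsWalk.induct {motive : ∀ x p, IsWalk G x y p → Prop}
    (nil : motive y [y] (isWalk_singleton.2 ⟨rfl, rfl⟩))
    (cons : ∀ a b l (hab : G.Adj a b) (hw : IsWalk G b y (b :: l)), motive b (b :: l) hw →
      motive a (a :: b :: l) (isWalk_cons_cons.2 ⟨rfl, hab, hw⟩))
    {x : V} {p : List V} (h : IsWalk G x y p) : motive x p h := by
  induction p generalizing x with
  | nil => simp [IsWalk] at h
  | cons a l ih =>
    cases l with
    | nil =>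
      obtain ⟨rfl, rfl⟩ := isWalk_singleton.1 h
      exact nil
    | cons b l =>
      obtain ⟨rfl, hab, hw⟩ := isWalk_cons_cons.1 h
      exact cons _ _ _ hab hw (ih hw)

lemma IsWalk.append (hp : IsWalk G x y p) (hq : IsWalk G y z q) :
    IsWalk G x z (p ++ q.tail) := by
  induction hp using IsWalk.induct with
  | nil => rw [hq.eq_cons] at hq; simpa using hq
  | cons a b l hab hw ih => exact isWalk_cons_cons.2 ⟨rfl, hab, ih⟩

lemma IsWalk.reverse (hp : IsWalk G x y p) : IsWalk G y x p.reverse := by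
  refine ⟨?_, ?_, ?_⟩
  · simpa using hp.2.1
  · simpa using hp.1
  · rw [List.isChain_reverse]
    exact hp.2.2.imp fun _ _ h => h.symm

lemma IsWalk.mono {G' : SimpleGraph V} (h : G ≤ G') (hp : IsWalk G x y p) : IsWalk G' x y p :=
  ⟨hp.1, hp.2.1, hp.2.2.imp fun _ _ e => h e⟩

lemma exists_isWalk_of_connected (h : G.Connected) (x y : V) : ∃ p, IsWalk G x y p := by
  obtain ⟨w⟩ := h.preconnected x y
  induction w with
  | nil => exact ⟨[_], isWalk_singleton.2 ⟨rfl, rfl⟩⟩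
  | cons hab w ih =>
    obtain ⟨p, hp⟩ := ih
    rw [hp.eq_cons] at hp
    exact ⟨_, isWalk_cons_cons.2 ⟨rfl, hab, hp⟩⟩

variable [PseudoMetricSpace V]

@[simp] lemma walkCost_nil : walkCost ([] : List V) = 0 := rfl
@[simp] lemma walkCost_singleton : walkCost [x] = 0 := rfl
@[simp] lemma walkCost_cons_cons : walkCost (x :: y :: p) = dist x y + walkCost (y :: p) := by
  simp [walkCost]

lemma walkCost_nonneg (p : List V) : 0 ≤ walkCost p := by
  induction p with
  | nil => simp
  | cons a l ih =>
    cases l with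
    | nil => simp
    | cons b l => rw [walkCost_cons_cons]; positivity

lemma walkCost_append_cons (p : List V) (x : V) (q : List V) :
    walkCost (p ++ x :: q) = walkCost (p ++ [x]) + walkCost (x :: q) := by
  induction p with
  | nil => simp
  | cons a l ih =>
    cases l with
    | nil => simp
    | cons b l =>
      simp only [List.cons_append, walkCost_cons_cons] at ih ⊢
      rw [ih]; ring

lemma walkCost_append_tail (hp : p.getLast? = some y) (hq : q.head? = some y) :
    walkCost (p ++ q.tail) = walkCost p + walkCost q := by
  obtain ⟨p', rfl⟩ := List.getLast?_eq_some_iff.1 hp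
  obtain ⟨q', rfl⟩ := List.head?_eq_some_iff.1 hq
  simpa using walkCost_append_cons p' y q'

lemma IsWalk.walkCost_append (hp : IsWalk G x y p) (hq : IsWalk G y z q) :
    walkCost (p ++ q.tail) = walkCost p + walkCost q :=
  walkCost_append_tail hp.2.1 hq.1

lemma walkCost_reverse (p : List V) : walkCost p.reverse = walkCost p := by
  induction p with
  | nil => simp
  | cons a l ih =>
    cases l with
    | nil => simp
    | cons b l =>
      rw [walkCost_cons_cons, ← ih]
      simp only [List.reverse_cons, List.append_assoc, List.cons_append, List.nil_append]
      rw [walkCost_append_cons]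
      simp [dist_comm, add_comm]

lemma walkCost_le_cons (x : V) (p : List V) : walkCost p ≤ walkCost (x :: p) := by
  cases p with
  | nil => simp
  | cons b l => rw [walkCost_cons_cons]; linarith [dist_nonneg (x := x) (y := b)]

lemma walkCost_cons_le_dist_add (x y : V) (p : List V) :
    walkCost (x :: p) ≤ dist x y + walkCost (y :: p) := by
  cases p with
  | nil => simp
  | cons b l => simp only [walkCost_cons_cons]; linarith [dist_triangle x y b]

/-- Skipping vertices does not increase the cost, by the triangle inequality. -/
lemma walkCost_le_of_sublist (h : p.Sublist q) : walkCost p ≤ walkCost q := by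
  suffices walkCost p ≤ walkCost q ∧ ∀ x, walkCost (x :: p) ≤ walkCost (x :: q) from this.1
  induction h with
  | slnil => simp
  | @cons l₁ l₂ a _ ih =>
    refine ⟨ih.1.trans (walkCost_le_cons _ _), fun x => ?_⟩
    rw [walkCost_cons_cons]
    exact (walkCost_cons_le_dist_add x a l₁).trans (by linarith [ih.2 a])
  | @cons_cons l₁ l₂ a _ ih =>
    refine ⟨ih.2 a, fun x => ?_⟩
    simp only [walkCost_cons_cons]
    linarith [ih.2 a]

lemma dist_le_walkCost (hx : p.head? = some x) (hy : p.getLast? = some y) :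
    dist x y ≤ walkCost p := by
  obtain ⟨l, rfl⟩ := List.head?_eq_some_iff.1 hx
  rcases List.eq_nil_or_concat l with rfl | ⟨l, z, rfl⟩
  · have : x = y := by simpa using hy
    simp [this]
  · have : z = y := by simpa [List.getLast?_cons] using hy
    subst this
    have : [x, z].Sublist (x :: l.concat z) := by simp
    simpa using walkCost_le_of_sublist this

/-- Cutting off cycles turns a walk into a path that is not more expensive. -/
lemma IsWalk.exists_isPath (h : IsWalk G x y p) :
    ∃ q, IsPath G x y q ∧ walkCost q ≤ walkCost p := by
  induction h using IsWalk.induct with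
  | nil => exact ⟨[y], ⟨isWalk_singleton.2 ⟨rfl, rfl⟩, by simp⟩, le_rfl⟩
  | cons a b l hab hw ih =>
    obtain ⟨q, hq, hle⟩ := ih
    by_cases ha : a ∈ q
    · obtain ⟨q₁, q₂, rfl⟩ := List.append_of_mem ha
      refine ⟨a :: q₂, ⟨⟨rfl, ?_, ?_⟩, ?_⟩, ?_⟩
      · simpa using hq.1.2.1
      · exact (List.isChain_append.1 hq.1.2.2).2.1
      · exact (List.nodup_append.1 hq.2).2.1
      · have := walkCost_le_of_sublist (List.sublist_append_right q₁ (a :: q₂))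
        rw [walkCost_cons_cons]
        linarith [dist_nonneg (x := a) (y := b)]
    · have hq' := hq.1.eq_cons
      rw [hq'] at hq hle ha
      refine ⟨a :: b :: q.tail, ⟨isWalk_cons_cons.2 ⟨rfl, hab, hq.1⟩, ?_⟩, ?_⟩
      · exact List.nodup_cons.2 ⟨ha, hq.2⟩
      · simp only [walkCost_cons_cons] at hle ⊢
        linarith

/-- The costs of walks are sums of elements of a finite set of non-negative numbers, hence they are
well-ordered, and there is a cheapest one in every nonempty set of walks. -/
lemma exists_min_walkCost [Finite V] {α : Type*} (f : α → List V) {Q : α → Prop}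
    (h : ∃ a, Q a) : ∃ a, Q a ∧ ∀ b, Q b → walkCost (f a) ≤ walkCost (f b) := by
  let D : Set ℝ := Set.range fun e : V × V => dist e.1 e.2
  have hD : (AddSubmonoid.closure D : Set ℝ).IsPWO := by
    refine Set.IsPWO.addSubmonoid_closure ?_ (Set.finite_range _).isPWO
    rintro _ ⟨e, rfl⟩
    exact dist_nonneg
  have mem : ∀ p : List V, walkCost p ∈ (AddSubmonoid.closure D : Set ℝ) := by
    intro p
    induction p with
    | nil => exact zero_mem (AddSubmonoid.closure D)
    | cons a l ih =>
      cases l with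
      | nil => exact zero_mem (AddSubmonoid.closure D)
      | cons b l =>
        rw [walkCost_cons_cons]
        exact add_mem (AddSubmonoid.subset_closure ⟨(a, b), rfl⟩) ih
  let C : Set ℝ := {c | ∃ a, Q a ∧ walkCost (f a) = c}
  have hC : C.IsWF := (hD.mono (by rintro _ ⟨a, _, rfl⟩; exact mem _)).isWF
  obtain ⟨a₀, ha₀⟩ := h
  have hne : C.Nonempty := ⟨_, a₀, ha₀, rfl⟩
  obtain ⟨a, ha, hmin⟩ := hC.min_mem hne
  exact ⟨a, ha, fun b hb => hmin ▸ hC.min_le hne ⟨b, hb, rfl⟩⟩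

lemma IsWalk.exists_isShortestPath [Finite V] (h : IsWalk G x y p) :
    ∃ q, IsShortestPath G x y q ∧ walkCost q ≤ walkCost p := by
  obtain ⟨q, hq, hle⟩ := h.exists_isPath
  obtain ⟨r, hr, hmin⟩ := exists_min_walkCost id ⟨q, hq⟩
  exact ⟨r, ⟨hr, hmin⟩, (hmin q hq).trans hle⟩

/-- The vertices on a walk have positions on a line, namely the costs of the walk up to there, that
are at least as far apart as the vertices are in the graph. -/
lemma IsWalk.exists_position (h : IsWalk G x y p) (hall : ∀ v, v ∈ p) :
    ∃ pos : V → ℝ, (∀ v, 0 ≤ pos v ∧ pos v ≤ walkCost p) ∧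
      ∀ u v, ∃ q, IsWalk G u v q ∧ walkCost q ≤ |pos u - pos v| := by
  have split : ∀ i j : ℕ, ∀ hij : i ≤ j, ∀ hj : j < p.length,
      ∃ q, IsWalk G (p[i]'(hij.trans_lt hj)) p[j] q ∧
        walkCost (p.take (j + 1)) = walkCost (p.take (i + 1)) + walkCost q := by
    intro i j hij
    induction j, hij using Nat.le_induction with
    | base => exact fun hj => ⟨[p[i]], isWalk_singleton.2 ⟨rfl, rfl⟩, by simp⟩
    | succ j hij ih =>
      intro hj
      obtain ⟨q, hq, hc⟩ := ih (by omega)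
      have hadj : G.Adj p[j] p[j + 1] := List.isChain_iff_getElem.1 h.2.2 j hj
      have h2 : IsWalk G p[j] p[j + 1] [p[j], p[j + 1]] :=
        isWalk_cons_cons.2 ⟨rfl, hadj, isWalk_singleton.2 ⟨rfl, rfl⟩⟩
      refine ⟨q ++ [p[j + 1]], hq.append h2, ?_⟩
      have e1 := hq.walkCost_append h2
      have e2 := walkCost_append_tail (p := p.take (j + 1)) (q := [p[j], p[j + 1]]) (y := p[j])
        (by simp [List.getLast?_take]) rfl
      rw [List.take_succ_eq_append_getElem hj]
      simp only [List.tail_cons, walkCost_cons_cons, walkCost_singleton] at e1 e2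
      rw [e1, e2, hc]; ring
  refine ⟨fun v => walkCost (p.take (p.idxOf v + 1)), fun v => ⟨walkCost_nonneg _,
    walkCost_le_of_sublist (List.take_sublist _ _)⟩, ?_⟩
  have hlt : ∀ v, p.idxOf v < p.length := fun v => List.idxOf_lt_length_iff.2 (hall v)
  have main : ∀ u v, p.idxOf u ≤ p.idxOf v → ∃ q, IsWalk G u v q ∧
      walkCost q ≤ |walkCost (p.take (p.idxOf u + 1)) - walkCost (p.take (p.idxOf v + 1))| := by
    intro u v huv
    obtain ⟨q, hq, hc⟩ := split _ _ huv (hlt v)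
    simp only [List.getElem_idxOf] at hq
    refine ⟨q, hq, ?_⟩
    rw [hc, abs_sub_comm]
    simpa using le_abs_self _
  intro u v
  rcases le_total (p.idxOf u) (p.idxOf v) with huv | huv
  · exact main u v huv
  · obtain ⟨q, hq, hc⟩ := main v u huv
    exact ⟨q.reverse, hq.reverse, by rwa [walkCost_reverse, abs_sub_comm]⟩

end WalkLemmas

/-! ### Eulerian cycles of multigraphs -/

section Euler

variable {V : Type*} {x y z : V}

@[simp] lemma walkEdges_singleton : walkEdges [x] = [] := rfl
@[simp] lemma walkEdges_cons_cons {p : List V} :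
    walkEdges (x :: y :: p) = s(x, y) :: walkEdges (y :: p) := by
  simp [walkEdges]

lemma walkEdges_append_cons (p : List V) (x : V) (q : List V) :
    walkEdges (p ++ x :: q) = walkEdges (p ++ [x]) ++ walkEdges (x :: q) := by
  induction p with
  | nil => simp
  | cons a l ih =>
    cases l with
    | nil => simp
    | cons b l =>
      simp only [List.cons_append, walkEdges_cons_cons] at ih ⊢
      rw [ih]

lemma mem_of_mem_walkEdges {p : List V} {e : Sym2 V} (he : e ∈ walkEdges p) (hx : x ∈ e) :
    x ∈ p := by
  induction p with
  | nil => simp [walkEdges] at he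
  | cons a l ih =>
    cases l with
    | nil => simp at he
    | cons b l =>
      rw [walkEdges_cons_cons, List.mem_cons] at he
      rcases he with rfl | he
      · rcases Sym2.mem_iff.1 hx with rfl | rfl <;> simp
      · exact List.mem_cons_of_mem _ (ih he)

/-- The degree of a vertex in the loopless multigraph with the edges `H`. -/
def multiDegree (H : Multiset (Sym2 V)) (v : V) : ℕ := H.countP (v ∈ ·)

lemma multiDegree_add (H K : Multiset (Sym2 V)) (v : V) :
    multiDegree (H + K) v = multiDegree H v + multiDegree K v :=
  Multiset.countP_add _ _ _

/-- The vertices of odd degree are exactly `x` and `y`, or there are none if `x = y`. -/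
def OddAtEnds (H : Multiset (Sym2 V)) (x y : V) : Prop :=
  ∀ v, Even (multiDegree H v) ↔ (v = x ↔ v = y)

lemma oddAtEnds_cons {H : Multiset (Sym2 V)} (hxz : x ≠ z) :
    OddAtEnds (s(x, z) ::ₘ H) x y ↔ OddAtEnds H z y := by
  refine forall_congr' fun v => ?_
  have : multiDegree (s(x, z) ::ₘ H) v = multiDegree H v + if v ∈ s(x, z) then 1 else 0 := by
    simp [multiDegree, Multiset.countP_cons]
  simp only [this, Sym2.mem_iff]
  by_cases h1 : v = x
  · have h2 : v ≠ z := h1 ▸ hxz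
    simp only [h1, true_or, if_true, Nat.even_add_one] at h2 ⊢
    simp only [h2, true_iff, false_iff]
    tauto
  · by_cases h2 : v = z
    · simp only [h2, or_true, if_true, Nat.even_add_one] at h1 ⊢
      simp only [h1, true_iff, false_iff]
      tauto
    · simp [h1, h2]

lemma oddAtEnds_walkEdges {p : List V} (hx : p.head? = some x) (hy : p.getLast? = some y)
    (hl : ∀ e ∈ walkEdges p, ¬ e.IsDiag) : OddAtEnds (walkEdges p : Multiset (Sym2 V)) x y := by
  induction p generalizing x with
  | nil => simp at hx
  | cons a l ih =>
    obtain rfl : a = x := by simpa using hx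
    cases l with
    | nil =>
      obtain rfl : a = y := by simpa using hy
      simp [OddAtEnds, multiDegree]
    | cons b l =>
      rw [walkEdges_cons_cons] at hl ⊢
      rw [← Multiset.cons_coe, oddAtEnds_cons (by simpa using hl s(a, b) (by simp))]
      exact ih rfl (by simpa using hy) fun e he => hl e (by simp [he])

lemma exists_mem_of_multiDegree_ne_zero {H : Multiset (Sym2 V)} (h : multiDegree H x ≠ 0) :
    ∃ z H', H = s(x, z) ::ₘ H' := by
  obtain ⟨e, he, hx⟩ := Multiset.countP_pos.1 (Nat.pos_of_ne_zero h)
  obtain ⟨z, rfl⟩ := Sym2.mem_iff_exists.1 hx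
  exact ⟨z, Multiset.exists_cons_of_mem he⟩

/-- A trail can be continued as long as it has not reached the other vertex of odd degree. -/
lemma exists_trail (H : Multiset (Sym2 V)) (hl : ∀ e ∈ H, ¬ e.IsDiag) (h : OddAtEnds H x y) :
    ∃ p : List V, p.head? = some x ∧ p.getLast? = some y ∧
      (walkEdges p : Multiset (Sym2 V)) ≤ H := by
  induction hn : H.card using Nat.strong_induction_on generalizing H x with
  | _ n ih =>
    by_cases hxy : x = y
    · exact ⟨[x], rfl, by simp [hxy], by simp⟩
    · have hodd : ¬ Even (multiDegree H x) := by simp [h x, hxy]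
      obtain ⟨z, H', rfl⟩ := exists_mem_of_multiDegree_ne_zero
        (H := H) (x := x) (fun h0 => hodd (by simp [h0]))
      have hxz : x ≠ z := by simpa using hl s(x, z) (by simp)
      obtain ⟨p, hp, hpy, hle⟩ := ih H'.card (by simp [← hn]) H'
        (fun e he => hl e (by simp [he])) ((oddAtEnds_cons hxz).1 h) rfl
      obtain ⟨l, rfl⟩ := List.head?_eq_some_iff.1 hp
      refine ⟨x :: z :: l, rfl, by simpa using hpy, ?_⟩
      rw [walkEdges_cons_cons, ← Multiset.cons_coe]
      exact Multiset.cons_le_cons _ hle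

lemma exists_closed_trail {H : Multiset (Sym2 V)} (hl : ∀ e ∈ H, ¬ e.IsDiag)
    (h : ∀ v, Even (multiDegree H v)) (hx : multiDegree H x ≠ 0) :
    ∃ p : List V, p.head? = some x ∧ p.getLast? = some x ∧
      (walkEdges p : Multiset (Sym2 V)) ≤ H ∧ walkEdges p ≠ [] := by
  obtain ⟨z, H', rfl⟩ := exists_mem_of_multiDegree_ne_zero hx
  have hxz : x ≠ z := by simpa using hl s(x, z) (by simp)
  have h' : OddAtEnds H' z x := (oddAtEnds_cons hxz).1 fun v => by simp [h v]
  obtain ⟨p, hp, hpy, hle⟩ := exists_trail H' (fun e he => hl e (by simp [he])) h'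
  obtain ⟨l, rfl⟩ := List.head?_eq_some_iff.1 hp
  refine ⟨x :: z :: l, rfl, by simpa using hpy, ?_, by simp⟩
  rw [walkEdges_cons_cons, ← Multiset.cons_coe]
  exact Multiset.cons_le_cons _ hle

lemma exists_adj_of_connected {G : SimpleGraph V} (hG : G.Connected) {A : Set V} (hx : x ∈ A)
    (hy : y ∉ A) : ∃ a b, G.Adj a b ∧ a ∈ A ∧ b ∉ A := by
  obtain ⟨w⟩ := hG.preconnected x y
  obtain ⟨d, -, h1, h2⟩ := w.exists_boundary_dart A hx hy
  exact ⟨d.fst, d.snd, d.adj, h1, h2⟩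

/-- Euler's theorem: a closed trail that misses some edges of a connected multigraph with even
degrees meets a missing edge, and a closed trail of missing edges can be inserted there. -/
theorem exists_isEulerianCycle {H : Multiset (Sym2 V)} (hl : ∀ e ∈ H, ¬ e.IsDiag)
    (heven : ∀ v, Even (multiDegree H v)) {G : SimpleGraph V} (hG : G.Connected)
    (hGH : ∀ e ∈ G.edgeSet, e ∈ H) (s : V) : ∃ w, IsEulerianCycle H s w := by
  suffices ∀ (n : ℕ) (w : List V) (R : Multiset (Sym2 V)), R.card = n → w.head? = some s →
      w.getLast? = some s → (walkEdges w : Multiset (Sym2 V)) + R = H →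
      ∃ w', IsEulerianCycle H s w' from
    this _ [s] H rfl rfl rfl (by simp)
  intro n
  induction n using Nat.strong_induction_on with
  | _ n ih =>
    intro w R hn hs ht hH
    by_cases hR : R = 0
    · exact ⟨w, hs, ht, by simpa [hR] using hH⟩
    have hlR : ∀ e ∈ R, ¬ e.IsDiag := fun e he => hl e (by rw [← hH]; simp [he])
    have hlw : ∀ e ∈ walkEdges w, ¬ e.IsDiag := fun e he => hl e (by rw [← hH]; simp [he])
    have hRe : ∀ v, Even (multiDegree R v) := fun v => by
      have h1 := heven v
      rw [← hH, multiDegree_add, Nat.even_add] at h1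
      exact h1.1 (by simp [oddAtEnds_walkEdges hs ht hlw v])
    obtain ⟨x, hxw, hxR⟩ : ∃ x ∈ w, multiDegree R x ≠ 0 := by
      suffices ∃ x ∈ w, ∃ e ∈ R, x ∈ e by
        obtain ⟨x, hx, e, he, hxe⟩ := this
        exact ⟨x, hx, (Multiset.countP_pos.2 ⟨e, he, hxe⟩).ne'⟩
      by_cases hall : ∀ v, v ∈ w
      · obtain ⟨e, he⟩ := Multiset.exists_mem_of_ne_zero hR
        induction e with
        | _ a b => exact ⟨a, hall a, _, he, by simp⟩
      · push Not at hall
        obtain ⟨v, hv⟩ := hall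
        obtain ⟨a, b, hab, ha, hb⟩ := exists_adj_of_connected hG (A := {v | v ∈ w})
          (List.mem_of_head? hs) hv
        have hm := hGH s(a, b) hab
        rw [← hH, Multiset.mem_add] at hm
        refine ⟨a, ha, s(a, b), hm.resolve_left fun hm => hb ?_, by simp⟩
        exact mem_of_mem_walkEdges (by simpa using hm) (by simp)
    obtain ⟨c, hc, hc', hle, hne⟩ := exists_closed_trail hlR hRe hxR
    obtain ⟨R', rfl⟩ := Multiset.le_iff_exists_add.1 hle
    obtain ⟨a, b, rfl⟩ := List.append_of_mem hxw
    obtain ⟨c, rfl⟩ := List.head?_eq_some_iff.1 hc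
    obtain ⟨d, hd⟩ := List.getLast?_eq_some_iff.1 hc'
    refine ih R'.card ?_ (a ++ (x :: c) ++ b) R' rfl ?_ ?_ ?_
    · rw [← hn]
      have := List.length_pos_iff.2 hne
      simp only [Multiset.card_add, Multiset.coe_card]
      omega
    · cases a <;> simpa using hs
    · rcases List.eq_nil_or_concat b with rfl | ⟨b, u, rfl⟩
      · obtain rfl : x = s := by simpa using ht
        simpa using hc'
      · have e : a ++ x :: b.concat u = (a ++ x :: b) ++ [u] := by simp
        rw [e, List.getLast?_concat] at ht
        rw [List.concat_eq_append, ← List.append_assoc, List.getLast?_concat, ht]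
    · rw [← hH, hd, walkEdges_append_cons a x b]
      have e1 : walkEdges (a ++ (d ++ [x]) ++ b) =
          walkEdges (a ++ [x]) ++ (walkEdges (d ++ [x]) ++ walkEdges (x :: b)) := by
        rw [← walkEdges_append_cons d x b]
        cases d with
        | nil => simp [walkEdges_append_cons a x b]
        | cons u d =>
          obtain rfl : x = u := by simpa using congrArg List.head? hd
          simp only [List.append_assoc, List.cons_append, List.nil_append]
          rw [walkEdges_append_cons a]
      rw [e1]
      simp only [← Multiset.coe_add]
      abel

end Euler

/-! ### Christofides' algorithm -/

section ChristofidesLemmas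

variable {V : Type*}

lemma even_ncard_oddVertices [Finite V] (T : SimpleGraph V) : Even (oddVertices T).ncard := by
  have := Fintype.ofFinite V
  have h := T.even_card_odd_degree_vertices
  rw [← Set.ncard_coe_finset] at h
  convert h using 2
  ext v
  simp [oddVertices, ← SimpleGraph.card_neighborSet_eq_degree, Set.ncard_eq_toFinset_card']

lemma multiDegree_edgesOf [Finite V] (E : Set (Sym2 V)) (v : V) :
    multiDegree (edgesOf E).val v = {e ∈ E | v ∈ e}.ncard := by
  rw [multiDegree, Multiset.countP_eq_card_filter, ← Finset.filter_val, Finset.card_val,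
    ← Set.ncard_coe_finset]
  congr 1
  ext e
  simp [edgesOf]

lemma ncard_incident_eq {N : Set V} {E : Set (Sym2 V)} {v : V}
    (h : ∀ u, s(v, u) ∈ E ↔ u ∈ N) : {e ∈ E | v ∈ e}.ncard = N.ncard := by
  have : {e ∈ E | v ∈ e} = (fun u => s(v, u)) '' N := by
    ext e
    constructor
    · rintro ⟨he, hv⟩
      obtain ⟨u, rfl⟩ := Sym2.mem_iff_exists.1 hv
      exact ⟨u, (h u).1 he, rfl⟩
    · rintro ⟨u, hu, rfl⟩
      exact ⟨(h u).2 hu, by simp⟩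
  rw [this]
  exact Set.ncard_image_of_injective _ fun a b hab => Sym2.congr_right.1 hab

lemma even_multiDegree [Finite V] {T : SimpleGraph V} {M : (⊤ : SimpleGraph V).Subgraph}
    (hM : M.IsMatching) (hv : M.verts = oddVertices T) (v : V) :
    Even (multiDegree ((edgesOf T.edgeSet).val + (edgesOf M.edgeSet).val) v) := by
  rw [multiDegree_add, multiDegree_edgesOf, multiDegree_edgesOf,
    ncard_incident_eq (N := T.neighborSet v) (by simp),
    ncard_incident_eq (N := M.neighborSet v) (by simp)]
  by_cases h : v ∈ M.verts
  · have h1 : (M.neighborSet v).ncard = 1 := by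
      obtain ⟨u, hu, huniq⟩ := hM h
      rw [Set.ncard_eq_one]
      exact ⟨u, Set.eq_singleton_iff_unique_mem.2 ⟨hu, huniq⟩⟩
    rw [hv] at h
    rw [h1, Nat.even_add_one, Nat.not_even_iff_odd]
    exact h
  · have h1 : (M.neighborSet v).ncard = 0 := by
      rw [Set.ncard_eq_zero, Set.eq_empty_iff_forall_notMem]
      exact fun u hu => h (M.edge_vert hu)
    rw [hv] at h
    rw [h1, add_zero, ← Nat.not_odd_iff_even]
    exact h

variable [PseudoMetricSpace V]

@[simp] lemma edgeCost_mk [Finite V] (x y : V) : edgeCost s(x, y) = dist x y := rfl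

lemma edgeCost_nonneg [Finite V] (e : Sym2 V) : 0 ≤ edgeCost e := by
  induction e with
  | _ x y => exact dist_nonneg

lemma walkCost_eq_sum [Finite V] (p : List V) : walkCost p = ((walkEdges p).map edgeCost).sum := by
  induction p with
  | nil => rfl
  | cons a l ih =>
    cases l with
    | nil => rfl
    | cons b l => simp [ih]

lemma edgeSetCost_eq [Finite V] (E : Set (Sym2 V)) :
    edgeSetCost E = ((edgesOf E).val.map edgeCost).sum := rfl

lemma edgeSetCost_le_walkCost [Finite V] {E : Set (Sym2 V)} {p : List V}
    (h : ∀ e ∈ E, e ∈ walkEdges p) : edgeSetCost E ≤ walkCost p := by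
  have hle : (edgesOf E).val ≤ (walkEdges p : Multiset (Sym2 V)) := by
    refine (Multiset.le_iff_subset (edgesOf E).nodup).2 fun e he => ?_
    have : e ∈ E := by simpa [edgesOf] using he
    exact h e this
  obtain ⟨R, hR⟩ := Multiset.le_iff_exists_add.1 hle
  have h1 : walkCost p = ((walkEdges p : Multiset (Sym2 V)).map edgeCost).sum := by
    simp [walkCost_eq_sum]
  rw [h1, hR, Multiset.map_add, Multiset.sum_add, edgeSetCost_eq]
  have : 0 ≤ (R.map edgeCost).sum := Multiset.sum_nonneg fun c hc => by
    obtain ⟨e, -, rfl⟩ := Multiset.mem_map.1 hc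
    exact edgeCost_nonneg e
  linarith

lemma exists_isMinSpanningTree [Finite V] [Nonempty V] :
    ∃ T : SimpleGraph V, IsMinSpanningTree T := by
  obtain ⟨T₀, -, hT₀⟩ := (SimpleGraph.connected_top (V := V)).exists_isTree_le
  obtain ⟨T, hT, hmin⟩ := Set.exists_min_image {T : SimpleGraph V | T.IsTree}
    (fun T => edgeSetCost T.edgeSet) (Set.toFinite _) ⟨T₀, hT₀⟩
  exact ⟨T, hT, hmin⟩

/-- The edges of a walk through all vertices contain a spanning tree. -/
lemma IsMinSpanningTree.cost_le [Finite V] {T : SimpleGraph V} (hT : IsMinSpanningTree T)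
    {G : SimpleGraph V} {x y : V} {t : List V} (ht : IsWalk G x y t) (hall : ∀ v, v ∈ t) :
    edgeSetCost T.edgeSet ≤ walkCost t := by
  let K : SimpleGraph V := SimpleGraph.fromEdgeSet {e | e ∈ walkEdges t}
  have hreach : ∀ v ∈ t, (SimpleGraph.fromEdgeSet {e | e ∈ walkEdges t}).Reachable v y := by
    clear hall K
    induction ht using IsWalk.induct with
    | nil => simp
    | cons a b l hab hw ih =>
      have hle : SimpleGraph.fromEdgeSet {e | e ∈ walkEdges (b :: l)} ≤
          SimpleGraph.fromEdgeSet {e | e ∈ walkEdges (a :: b :: l)} :=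
        SimpleGraph.fromEdgeSet_mono fun e he => by
          simp only [walkEdges_cons_cons, List.mem_cons, Set.mem_ofPred_eq] at he ⊢
          exact Or.inr he
      have hb := (ih b (by simp)).mono hle
      intro v hv
      rcases List.mem_cons.1 hv with rfl | hv
      · refine (SimpleGraph.Adj.reachable ?_).trans hb
        simp [SimpleGraph.fromEdgeSet_adj, hab.ne]
      · exact (ih v hv).mono hle
  have hK : K.Connected :=
    { preconnected := fun u v => (hreach u (hall u)).trans (hreach v (hall v)).symm
      nonempty := ⟨x⟩ }
  obtain ⟨T', hle, hT'⟩ := hK.exists_isTree_le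
  refine (hT.2 T' hT').trans (edgeSetCost_le_walkCost fun e he => ?_)
  have := SimpleGraph.edgeSet_mono hle he
  rw [SimpleGraph.edgeSet_fromEdgeSet] at this
  exact this.1

/-- Matching the vertices of a list in consecutive pairs. -/
lemma exists_isMatching_of_list [Finite V] (n : ℕ) : ∀ l : List V, l.Nodup → l.length = 2 * n →
    ∃ M : (⊤ : SimpleGraph V).Subgraph, M.IsMatching ∧ M.verts = {v | v ∈ l} ∧
      edgeSetCost M.edgeSet ≤ walkCost l := by
  induction n with
  | zero =>
    intro l _ hlen
    obtain rfl := List.eq_nil_of_length_eq_zero hlen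
    exact ⟨⊥, by simp [SimpleGraph.Subgraph.IsMatching], by simp,
      by simp [edgeSetCost, edgesOf]⟩
  | succ n ih =>
    intro l hnd hlen
    match l, hnd, hlen with
    | [], _, h => simp at h
    | [_], _, h => simp at h; omega
    | a :: b :: l, hnd, hlen =>
      have hab : a ≠ b := by rintro rfl; simp at hnd
      obtain ⟨M, hM, hv, hc⟩ := ih l (by simp at hnd; exact hnd.2.2) (by simp at hlen; omega)
      have hadj : (⊤ : SimpleGraph V).Adj a b := hab
      refine ⟨(⊤ : SimpleGraph V).subgraphOfAdj hadj ⊔ M, ?_, ?_, ?_⟩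
      · refine SimpleGraph.Subgraph.IsMatching.sup
          (SimpleGraph.Subgraph.IsMatching.subgraphOfAdj hadj) hM ?_
        rw [hM.support_eq_verts,
          (SimpleGraph.Subgraph.IsMatching.subgraphOfAdj hadj).support_eq_verts, hv, Set.disjoint_left]
        simp only [SimpleGraph.subgraphOfAdj_verts, Set.mem_insert_iff, Set.mem_singleton_iff,
          Set.mem_ofPred_eq]
        simp only [List.nodup_cons, List.mem_cons, not_or] at hnd
        rintro v (rfl | rfl)
        · exact hnd.1.2
        · exact hnd.2.1
      · ext v
        simp [hv, or_assoc]
      · have hE : edgesOf ((⊤ : SimpleGraph V).subgraphOfAdj hadj ⊔ M).edgeSet =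
            insert s(a, b) (edgesOf M.edgeSet) := by
          ext e
          simp [edgesOf, SimpleGraph.Subgraph.edgeSet_sup]
        have h1 : edgeSetCost ((⊤ : SimpleGraph V).subgraphOfAdj hadj ⊔ M).edgeSet ≤
            dist a b + edgeSetCost M.edgeSet := by
          unfold edgeSetCost
          rw [hE]
          by_cases hm : s(a, b) ∈ edgesOf M.edgeSet
          · rw [Finset.insert_eq_of_mem hm]
            linarith [dist_nonneg (x := a) (y := b)]
          · rw [Finset.sum_insert hm, edgeCost_mk]
        rw [walkCost_cons_cons]
        linarith [walkCost_le_cons b l]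

/-- The vertices of odd degree are an even number. Matched in the order in which a walk `t` visits
them, they cost at most as much as `t`. -/
lemma exists_isMatching_oddVertices [Finite V] (T : SimpleGraph V) {t : List V}
    (hall : ∀ v, v ∈ t) : ∃ M : (⊤ : SimpleGraph V).Subgraph, M.IsMatching ∧
      M.verts = oddVertices T ∧ edgeSetCost M.edgeSet ≤ walkCost t := by
  let l := t.dedup.filter (· ∈ oddVertices T)
  have hnd : l.Nodup := (List.nodup_dedup t).filter _
  have hset : {v | v ∈ l} = oddVertices T := by
    ext v; simp [l, hall v]
  have hlen : l.length = (oddVertices T).ncard := by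
    rw [← hset, ← List.toFinset_card_of_nodup hnd, ← Set.ncard_coe_finset]
    congr 1; ext v; simp
  obtain ⟨n, hn⟩ := even_ncard_oddVertices T
  obtain ⟨M, hM, hv, hc⟩ := exists_isMatching_of_list n l hnd (by omega)
  refine ⟨M, hM, hv.trans hset, hc.trans (walkCost_le_of_sublist ?_)⟩
  exact List.filter_sublist.trans (List.dedup_sublist t)

lemma exists_isMinPerfectMatching [Finite V] (T : SimpleGraph V) :
    ∃ M, IsMinPerfectMatching (oddVertices T) M := by
  have := Fintype.ofFinite V
  obtain ⟨M₀, h₀, h₀', -⟩ := exists_isMatching_oddVertices T (t := Finset.univ.toList) (by simp)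
  obtain ⟨M, hM, hmin⟩ := Set.exists_min_image
    {M : (⊤ : SimpleGraph V).Subgraph | M.IsMatching ∧ M.verts = oddVertices T}
    (fun M => edgeSetCost M.edgeSet) (Set.toFinite _) ⟨M₀, h₀, h₀'⟩
  exact ⟨M, hM, fun M' h h' => hmin M' ⟨h, h'⟩⟩

theorem exists_isChristofidesTour [Finite V] (s : V) : ∃ P, IsChristofidesTour s P := by
  have : Nonempty V := ⟨s⟩
  obtain ⟨T, hT⟩ := exists_isMinSpanningTree (V := V)
  obtain ⟨M, hM⟩ := exists_isMinPerfectMatching T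
  obtain ⟨w, hw⟩ := exists_isEulerianCycle
    (H := (edgesOf T.edgeSet).val + (edgesOf M.edgeSet).val)
    (by
      intro e he
      rw [Multiset.mem_add] at he
      rcases he with he | he
      · exact T.not_isDiag_of_mem_edgeSet (by simpa [edgesOf] using he)
      · exact (⊤ : SimpleGraph V).not_isDiag_of_mem_edgeSet
          (M.edgeSet_subset (by simpa [edgesOf] using he)))
    (even_multiDegree hM.1.1 hM.1.2) hT.1.connected
    (fun e he => Multiset.mem_add.2 (Or.inl (by simpa [edgesOf] using he))) s
  have hall : ∀ v, v ∈ w := by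
    by_contra! hv
    obtain ⟨v, hv⟩ := hv
    obtain ⟨a, b, hab, ha, hb⟩ := exists_adj_of_connected hT.1.connected (A := {v | v ∈ w})
      (List.mem_of_head? hw.1) hv
    have hm : s(a, b) ∈ (edgesOf T.edgeSet).val + (edgesOf M.edgeSet).val :=
      Multiset.mem_add.2 (Or.inl (by simpa [edgesOf] using hab))
    rw [← hw.2.2] at hm
    exact hb (mem_of_mem_walkEdges (Multiset.mem_coe.1 hm) (by simp))
  obtain ⟨l, rfl⟩ := List.head?_eq_some_iff.1 hw.1
  -- `dedup` keeps last occurrences, so the first occurrence of `s` is put in front separately.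
  refine ⟨s :: l.dedup.filter (· ≠ s), T, M, _, hT, hM, hw, ?_, rfl, ?_, ?_⟩
  · exact (List.filter_sublist.trans (List.dedup_sublist l)).cons_cons s
  · exact List.nodup_cons.2 ⟨by simp, (List.nodup_dedup l).filter _⟩
  · intro v
    by_cases h : v = s
    · simp [h]
    · have := hall v
      simpa [h] using this

/-- The spanning tree and the matching each cost at most as much as a tour. -/
theorem IsChristofidesTour.walkCost_le [Finite V] {s : V} {P : List V}
    (hP : IsChristofidesTour s P) {G : SimpleGraph V} {x y : V} {t : List V}
    (ht : IsWalk G x y t) (hall : ∀ v, v ∈ t) : walkCost P ≤ 2 * walkCost t := by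
  obtain ⟨T, M, w, hT, hM, hw, hsub, -⟩ := hP
  obtain ⟨M', hM', hv', hc'⟩ := exists_isMatching_oddVertices T hall
  have h1 := hT.cost_le ht hall
  have h2 := (hM.2 M' hM' hv').trans hc'
  have h3 : walkCost w = edgeSetCost T.edgeSet + edgeSetCost M.edgeSet := by
    have : walkCost w = ((walkEdges w : Multiset (Sym2 V)).map edgeCost).sum := by
      simp [walkCost_eq_sum]
    rw [this, hw.2.2, Multiset.map_add, Multiset.sum_add, edgeSetCost_eq, edgeSetCost_eq]
  linarith [walkCost_le_of_sublist hsub]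

end ChristofidesLemmas

/-! ### Nearest Neighbor on the compressed graph -/

section NearestNeighborLemmas

variable {V : Type*}

lemma Travel.isWalk {G : SimpleGraph V} {E : RouteGraph V} {S : Set V}
    (hE : ∀ x y p, E x y p → IsWalk G x y p) {x y : V} {p : List V} (h : Travel E S x y p) :
    IsWalk G x y p := by
  induction h with
  | nil x => exact isWalk_singleton.2 ⟨rfl, rfl⟩
  | cons _ he _ ih => exact (hE _ _ _ he).append ih

lemma knownGraph_le (B : SimpleGraph V) (U : Set V) : knownGraph B U ≤ Bᶜ := fun _ _ h => h.1

lemma ncard_diff_insert [Finite V] {U S : Set V} {u : V} (hu : u ∈ U \ S) :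
    (U \ insert u S).ncard + 1 = (U \ S).ncard := by
  rw [← Set.ncard_sdiff_singleton_add_one hu (Set.toFinite _)]
  congr 2
  ext v
  simp only [Set.mem_sdiff, Set.mem_insert_iff, Set.mem_singleton_iff]
  tauto

variable [PseudoMetricSpace V]

lemma NearestNeighbor.isWalk {G : SimpleGraph V} {E : RouteGraph V} {U S : Set V} {s c : V}
    {w : List V} (hE : ∀ x y p, E x y p → IsWalk G x y p) (h : NearestNeighbor E U s S c w) :
    IsWalk G c s w := by
  induction h with
  | done _ ht _ => exact ht.isWalk hE
  | visit _ ht _ _ ih => exact (ht.isWalk hE).append ih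

lemma NearestNeighbor.mem {G : SimpleGraph V} {E : RouteGraph V} {U S : Set V} {s c : V}
    {w : List V} (hE : ∀ x y p, E x y p → IsWalk G x y p) (h : NearestNeighbor E U s S c w)
    {v : V} (hv : v ∈ U \ S) : v ∈ w := by
  induction h with
  | done hU => exact absurd (hU hv.1) hv.2
  | @visit S c u p q hu ht _ hq ih =>
    by_cases hvu : v = u
    · exact List.mem_append_left _ (hvu ▸ (ht.isWalk hE).getLast_mem)
    · have h1 := ih ⟨hv.1, by simp [hvu, hv.2]⟩
      rw [(hq.isWalk hE).eq_cons, List.mem_cons] at h1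
      exact List.mem_append_right _ (h1.resolve_left hvu)

lemma compress_isWalk {B : SimpleGraph V} {U : Set V} (x y : V) (p : List V)
    (h : compress B U x y p) : IsWalk Bᶜ x y p := by
  obtain ⟨-, -, hxy, ⟨hB, rfl⟩ | hp⟩ := h
  · refine isWalk_cons_cons.2 ⟨rfl, ?_, isWalk_singleton.2 ⟨rfl, rfl⟩⟩
    exact (SimpleGraph.compl_adj _ _ _).2 ⟨hxy, hB⟩
  · exact hp.1.1.mono (knownGraph_le B U)

variable [Finite V] {B : SimpleGraph V} {U S : Set V}

/-- An unblocked walk that starts at an explored vertex can be followed in the compressed graph,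
without additional cost, until it reaches an unexplored vertex for the first time or ends. The walk
`p` is the part of it that has been followed since the last vertex in `U`. -/
lemma exists_travel_aux {a y : V} (hSU : S ⊆ U) (hy : y ∈ U) {r : List V} (hr : IsWalk Bᶜ a y r) :
    ∀ c ∈ S, ∀ p, IsWalk (knownGraph B U) c a p → (a ∈ U → a = c) →
      ∃ z q, Travel (compress B U) S c z q ∧ walkCost q ≤ walkCost p + walkCost r ∧
        (z = y ∨ z ∈ U \ S) := by
  induction hr using IsWalk.induct with
  | nil =>
    intro c hc p _ ha
    obtain rfl := ha hy
    exact ⟨y, [y], .nil y, by simp [walkCost_nonneg], .inl rfl⟩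
  | cons a b l hab _ ih =>
    intro c hc p hp ha
    by_cases hb : b ∈ U
    · by_cases hbc : b = c
      · subst hbc
        obtain ⟨z, q, h1, h2, h3⟩ := ih b hc [b] (isWalk_singleton.2 ⟨rfl, rfl⟩) fun _ => rfl
        refine ⟨z, q, h1, h2.trans ?_, h3⟩
        rw [walkCost_cons_cons, walkCost_singleton]
        linarith [walkCost_nonneg p, dist_nonneg (x := a) (y := b)]
      · obtain ⟨e, he, hle⟩ : ∃ e, compress B U c b e ∧ walkCost e ≤ walkCost p + dist a b := by
          by_cases haU : a ∈ U
          · obtain rfl := ha haU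
            refine ⟨[a, b], ⟨haU, hb, Ne.symm hbc,
              .inl ⟨((SimpleGraph.compl_adj _ _ _).1 hab).2, rfl⟩⟩, ?_⟩
            simp [walkCost_nonneg]
          · have h2 : IsWalk (knownGraph B U) a b [a, b] :=
              isWalk_cons_cons.2 ⟨rfl, ⟨hab, .inl haU⟩, isWalk_singleton.2 ⟨rfl, rfl⟩⟩
            obtain ⟨e, he, hle⟩ := (hp.append h2).exists_isShortestPath
            rw [hp.walkCost_append h2] at hle
            exact ⟨e, ⟨hSU hc, hb, Ne.symm hbc, .inr he⟩, by simpa using hle⟩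
        have hew := compress_isWalk _ _ _ he
        by_cases hbS : b ∈ S
        · obtain ⟨z, q, h1, h2, h3⟩ := ih b hbS [b] (isWalk_singleton.2 ⟨rfl, rfl⟩) fun _ => rfl
          refine ⟨z, e ++ q.tail, .cons hc he h1, ?_, h3⟩
          rw [hew.walkCost_append (h1.isWalk compress_isWalk), walkCost_cons_cons]
          rw [walkCost_singleton] at h2
          linarith
        · refine ⟨b, e ++ [b].tail, .cons hc he (.nil b), ?_, .inr ⟨hb, hbS⟩⟩
          rw [walkCost_cons_cons, List.tail_cons, List.append_nil]
          linarith [walkCost_nonneg (b :: l)]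
    · have h2 : IsWalk (knownGraph B U) a b [a, b] :=
        isWalk_cons_cons.2 ⟨rfl, ⟨hab, .inr hb⟩, isWalk_singleton.2 ⟨rfl, rfl⟩⟩
      obtain ⟨z, q, h1, h3, h4⟩ := ih c hc _ (hp.append h2) fun h => absurd h hb
      refine ⟨z, q, h1, h3.trans (le_of_eq ?_), h4⟩
      rw [hp.walkCost_append h2]
      simp [add_assoc]

lemma exists_travel {c y : V} (hSU : S ⊆ U) (hc : c ∈ S) (hy : y ∈ U) {r : List V}
    (hr : IsWalk Bᶜ c y r) :
    ∃ z q, Travel (compress B U) S c z q ∧ walkCost q ≤ walkCost r ∧ (z = y ∨ z ∈ U \ S) := by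
  simpa using exists_travel_aux hSU hy hr c hc [c] (isWalk_singleton.2 ⟨rfl, rfl⟩) fun _ => rfl

/-- Let `ℓ x` be the cost of the step that Nearest Neighbor takes when it leaves `x`. If `x` is left
before `y` is explored, then going from `x` to `y` was an option, and therefore `ℓ x` is at most the
distance of the two in the unblocked graph. -/
lemma NearestNeighbor.exists_steps {s c : V} {w : List V} {W : ℝ} {pos : V → ℝ}
    (hpos : ∀ v, 0 ≤ pos v ∧ pos v ≤ W)
    (hwalk : ∀ u v, ∃ q, IsWalk Bᶜ u v q ∧ walkCost q ≤ |pos u - pos v|)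
    (h : NearestNeighbor (compress B U) U s S c w) (hs : s ∈ U) (hSU : S ⊆ U) (hc : c ∈ S) :
    ∃ (F : Finset V) (ℓ : V → ℝ), (∀ x ∈ F, x = c ∨ x ∈ U \ S) ∧ F.card ≤ (U \ S).ncard ∧
      (∀ x ∈ F, 0 ≤ ℓ x ∧ ℓ x ≤ W) ∧
      (∀ x ∈ F, ∀ y ∈ F, x ≠ y → min (ℓ x) (ℓ y) ≤ |pos x - pos y|) ∧
      walkCost w ≤ W + ∑ x ∈ F, ℓ x := by
  have hW : ∀ u v, |pos u - pos v| ≤ W := fun u v => by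
    rw [abs_le]
    constructor <;> linarith [(hpos u).1, (hpos u).2, (hpos v).1, (hpos v).2]
  induction h with
  | @done S c p hUS _ hmin =>
    refine ⟨∅, 0, by simp, by simp, by simp, by simp, ?_⟩
    obtain ⟨r, hr, hrc⟩ := hwalk c s
    obtain ⟨z, q, h1, h2, rfl | h3⟩ := exists_travel hSU hc hs hr
    · simpa using (hmin q h1).trans (h2.trans (hrc.trans (hW _ _)))
    · exact absurd (hUS h3.1) h3.2
  | @visit S c u p q hu ht hmin hq ih =>
    obtain ⟨F, ℓ, hF, hcard, hℓ, hmn, hcost⟩ := ih (Set.insert_subset hu.1 hSU) (by simp)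
    have hFU : ∀ x ∈ F, x ∈ U \ S := by
      intro x hx
      rcases hF x hx with rfl | h
      · exact hu
      · exact ⟨h.1, fun h' => h.2 (by simp [h'])⟩
    have hcF : c ∉ F := fun h => (hFU c h).2 hc
    have hstep : ∀ y ∈ U \ S, walkCost p ≤ |pos c - pos y| := by
      intro y hy
      obtain ⟨r, hr, hrc⟩ := hwalk c y
      obtain ⟨z, q, h1, h2, h3⟩ := exists_travel hSU hc hy.1 hr
      have hz : z ∈ U \ S := h3.elim (fun h => h ▸ hy) id
      exact (hmin z hz q h1).trans (h2.trans hrc)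
    have hne : ∀ x ∈ F, x ≠ c := fun x hx h => hcF (h ▸ hx)
    refine ⟨insert c F, Function.update ℓ c (walkCost p), ?_, ?_, ?_, ?_, ?_⟩
    · intro x hx
      rcases Finset.mem_insert.1 hx with rfl | hx
      · exact .inl rfl
      · exact .inr (hFU x hx)
    · rw [Finset.card_insert_of_notMem hcF, ← ncard_diff_insert hu]
      omega
    · intro x hx
      rcases Finset.mem_insert.1 hx with rfl | hx
      · simpa using ⟨walkCost_nonneg p, (hstep u hu).trans (hW _ _)⟩
      · simpa [hne x hx] using hℓ x hx
    · intro x hx y hy hxy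
      rcases Finset.mem_insert.1 hx with rfl | hxF <;>
        rcases Finset.mem_insert.1 hy with rfl | hyF
      · exact absurd rfl hxy
      · exact (min_le_left _ _).trans (by simpa using hstep y (hFU y hyF))
      · rw [abs_sub_comm]
        exact (min_le_right _ _).trans (by simpa using hstep x (hFU x hxF))
      · simpa [hne x hxF, hne y hyF] using hmn x hxF y hyF hxy
    · rw [Finset.sum_insert hcF, Function.update_self, (ht.isWalk compress_isWalk).walkCost_append
        (hq.isWalk compress_isWalk), Finset.sum_congr rfl fun x hx =>
          Function.update_of_ne (hne x hx) (walkCost p) ℓ]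
      linarith

end NearestNeighborLemmas

section HarmonicBound

/-- Points in `[0, W]` that are pairwise at least `m` apart are few. -/
lemma card_mul_le_of_separated {α : Type*} {F : Finset α} {pos : α → ℝ} {W m : ℝ} (hm : 0 ≤ m)
    (hmW : m ≤ W) (hpos : ∀ x ∈ F, 0 ≤ pos x ∧ pos x ≤ W)
    (hsep : ∀ x ∈ F, ∀ y ∈ F, x ≠ y → m ≤ |pos x - pos y|) : F.card * m ≤ 2 * W := by
  rcases hm.eq_or_lt with rfl | hm
  · simp [hmW]
  -- The intervals `[i * m, (i + 1) * m)` contain at most one of the points each.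
  have hinj : Set.InjOn (fun x => ⌊pos x / m⌋₊) F := by
    intro x hx y hy hxy
    by_contra hne
    have h1 : |pos x / m - pos y / m| < 1 := by
      have hx1 := Nat.floor_le (div_nonneg (hpos x hx).1 hm.le)
      have hy1 := Nat.floor_le (div_nonneg (hpos y hy).1 hm.le)
      have hx2 := Nat.lt_floor_add_one (pos x / m)
      have hy2 := Nat.lt_floor_add_one (pos y / m)
      simp only at hxy
      rw [hxy] at hx1 hx2
      rw [abs_lt]
      constructor <;> linarith
    rw [← sub_div, abs_div, abs_of_pos hm, div_lt_one hm] at h1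
    exact absurd h1 (hsep x hx y hy hne).not_gt
  have hmaps : Set.MapsTo (fun x => ⌊pos x / m⌋₊) F (Finset.range (⌊W / m⌋₊ + 1)) := by
    intro x hx
    simp only [Finset.coe_range, Set.mem_Iio, Nat.lt_succ_iff]
    exact Nat.floor_le_floor (div_le_div_of_nonneg_right (hpos x hx).2 hm.le)
  have hcard := Finset.card_le_card_of_injOn _ hmaps hinj
  rw [Finset.card_range] at hcard
  have h2 : (F.card : ℝ) ≤ W / m + 1 := by
    have h3 : (F.card : ℝ) ≤ (⌊W / m⌋₊ : ℝ) + 1 := by exact_mod_cast hcard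
    exact h3.trans (by
      gcongr; exact Nat.floor_le (div_nonneg (hm.le.trans hmW) hm.le))
  calc F.card * m ≤ (W / m + 1) * m := by gcongr
    _ = W + m := by field_simp
    _ ≤ 2 * W := by linarith

/-- The `n`-th largest of the numbers `ℓ x` is at most `2 * W / n`, because `n` of the points are at
least that number apart from each other. -/
lemma sum_le_harmonic {α : Type*} {F : Finset α} {pos ℓ : α → ℝ} {W : ℝ}
    (hpos : ∀ x ∈ F, 0 ≤ pos x ∧ pos x ≤ W) (hℓ : ∀ x ∈ F, 0 ≤ ℓ x ∧ ℓ x ≤ W)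
    (hsep : ∀ x ∈ F, ∀ y ∈ F, x ≠ y → min (ℓ x) (ℓ y) ≤ |pos x - pos y|) :
    ∑ x ∈ F, ℓ x ≤ 2 * W * harmonic F.card := by
  induction hn : F.card generalizing F with
  | zero => simp [Finset.card_eq_zero.1 hn]
  | succ n ih =>
    obtain ⟨a, ha, hmin⟩ := F.exists_min_image ℓ (Finset.card_pos.1 (by omega))
    have h1 : ((n + 1 : ℕ) : ℝ) * ℓ a ≤ 2 * W := by
      rw [← hn]
      exact card_mul_le_of_separated (hℓ a ha).1 (hℓ a ha).2 hpos fun x hx y hy hxy =>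
        (le_min (hmin x hx) (hmin y hy)).trans (hsep x hx y hy hxy)
    have h2 := ih (F := F.erase a) (fun x hx => hpos x (Finset.mem_of_mem_erase hx))
      (fun x hx => hℓ x (Finset.mem_of_mem_erase hx))
      (fun x hx y hy => hsep x (Finset.mem_of_mem_erase hx) y (Finset.mem_of_mem_erase hy))
      (by rw [Finset.card_erase_of_mem ha, hn]; rfl)
    rw [← Finset.add_sum_erase F ℓ ha, harmonic_succ]
    push_cast
    have hpos' : (0 : ℝ) < n + 1 := by positivity
    have h3 : ℓ a ≤ 2 * W * (n + 1 : ℝ)⁻¹ := by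
      rw [← div_eq_mul_inv, le_div_iff₀ hpos']
      push_cast at h1
      linarith
    linarith

end HarmonicBound

section NearestNeighborBound

variable {V : Type*} [PseudoMetricSpace V] [Finite V] {B : SimpleGraph V} {U : Set V}

theorem NearestNeighborRoute.walkCost_le {s : V} {w t : List V} {k : ℕ}
    (h : NearestNeighborRoute (compress B U) U s w) (hs : s ∈ U) (ht : IsTour B s t)
    (hk : (U \ {s}).ncard ≤ k) : walkCost w ≤ walkCost t * (3 + 2 * Real.log k) := by
  obtain ⟨pos, hpos, hwalk⟩ := ht.1.exists_position ht.2
  obtain ⟨F, ℓ, -, hcard, hℓ, hsep, hcost⟩ :=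
    NearestNeighbor.exists_steps hpos hwalk h hs (by simpa using hs) rfl
  have h1 := sum_le_harmonic (fun x _ => hpos x) hℓ hsep
  have h2 := harmonic_le_one_add_log F.card
  have h3 : Real.log F.card ≤ Real.log k := by
    rcases Nat.eq_zero_or_pos F.card with h0 | h0
    · rw [h0, Nat.cast_zero, Real.log_zero]
      exact Real.log_natCast_nonneg k
    · exact Real.log_le_log (by exact_mod_cast h0) (by exact_mod_cast hcard.trans hk)
  have h4 : 2 * walkCost t * (harmonic F.card : ℝ) ≤ 2 * walkCost t * (1 + Real.log k) :=
    mul_le_mul_of_nonneg_left (h2.trans (by linarith)) (by linarith [walkCost_nonneg t])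
  linarith

end NearestNeighborBound

/-! ### ShortCut and the competitive ratio -/

section ShortCut

variable {V : Type*} {B : SimpleGraph V}

lemma shortCutPath_eq_cons (B : SimpleGraph V) (v : V) (l : List V) :
    shortCutPath B v l = v :: (shortCutPath B v l).tail := by
  induction l with
  | nil => rfl
  | cons u l ih =>
    rw [shortCutPath]
    split_ifs
    · exact ih
    · rfl

lemma shortCutPath_sublist (B : SimpleGraph V) (v : V) (l : List V) :
    (shortCutPath B v l).Sublist (v :: l) := by
  induction l generalizing v with
  | nil => exact List.Sublist.refl _
  | cons u l ih =>
    rw [shortCutPath]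
    split_ifs
    · exact (ih v).trans ((List.sublist_cons_self u l).cons_cons v)
    · exact (ih u).cons_cons v

lemma shortCutPath_isWalk {v : V} {l : List V} (h : (v :: l).Nodup) :
    ∃ y, IsWalk Bᶜ v y (shortCutPath B v l) := by
  induction l generalizing v with
  | nil => exact ⟨v, isWalk_singleton.2 ⟨rfl, rfl⟩⟩
  | cons u l ih =>
    rw [shortCutPath]
    have h' := h
    simp only [List.nodup_cons, List.mem_cons, not_or] at h'
    split_ifs with hB
    · exact ih (List.nodup_cons.2 ⟨h'.1.2, h'.2.2⟩)
    · obtain ⟨y, hy⟩ := ih (List.nodup_cons.2 h'.2)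
      refine ⟨y, ?_⟩
      rw [shortCutPath_eq_cons] at hy ⊢
      exact isWalk_cons_cons.2 ⟨rfl, (SimpleGraph.compl_adj _ _ _).2 ⟨h'.1.1, hB⟩, hy⟩

/-- A vertex is skipped only because of a blocked edge to it. -/
lemma exists_adj_of_notMem_shortCutPath {v u : V} {l : List V} (hu : u ∈ l)
    (h : u ∉ shortCutPath B v l) : ∃ c ∈ shortCutPath B v l, B.Adj c u := by
  induction l generalizing v with
  | nil => simp at hu
  | cons a l ih =>
    rw [shortCutPath] at h ⊢
    split_ifs at h ⊢ with hB
    · rcases List.mem_cons.1 hu with rfl | hu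
      · exact ⟨v, by rw [shortCutPath_eq_cons]; simp, hB⟩
      · exact ih hu h
    · rcases List.mem_cons.1 hu with rfl | hu
      · exact absurd (by rw [shortCutPath_eq_cons B u]; simp) h
      · obtain ⟨c, hc, hcu⟩ := ih (v := a) hu fun h' => h (List.mem_cons_of_mem _ h')
        exact ⟨c, List.mem_cons_of_mem _ hc, hcu⟩

/-- There are at most as many vertices left after `ShortCut` as there are blocked edges: different
vertices have been skipped because of different edges. -/
lemma ncard_remaining_le [Finite V] {s : V} {P : List V} (hs : P.head? = some s)
    (hall : ∀ v, v ∈ P) : (remaining B s P \ {s}).ncard ≤ B.edgeSet.ncard := by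
  obtain ⟨l, rfl⟩ := List.head?_eq_some_iff.1 hs
  have hskip : ∀ v ∈ remaining B s (s :: l) \ {s},
      v ∉ shortCutPath B s l ∧ ∃ c ∈ shortCutPath B s l, B.Adj c v := by
    rintro v ⟨hv, hvs⟩
    have hv' : v ∉ shortCutPath B s l := hv.resolve_left hvs
    exact ⟨hv', exists_adj_of_notMem_shortCutPath ((List.mem_cons.1 (hall v)).resolve_left hvs) hv'⟩
  have hex : ∀ v, ∃ c, v ∈ remaining B s (s :: l) \ {s} →
      c ∈ shortCutPath B s l ∧ B.Adj c v := by
    intro v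
    by_cases hv : v ∈ remaining B s (s :: l) \ {s}
    · obtain ⟨c, hc⟩ := (hskip v hv).2
      exact ⟨c, fun _ => hc⟩
    · exact ⟨v, fun h => absurd h hv⟩
  choose f hf using hex
  refine Set.ncard_le_ncard_of_injOn (fun v => s(f v, v)) (fun v hv => (hf v hv).2) ?_
    (Set.toFinite _)
  intro v hv w hw hvw
  rcases Sym2.eq_iff.1 hvw with h | h
  · exact h.2
  · exact absurd (h.1 ▸ (hf v hv).1) (hskip w hw).1

lemma shortCut_cases {s : V} {P : List V} (hs : P.head? = some s) (hnd : P.Nodup) :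
    ∃ y, IsWalk Bᶜ s y (shortCutPath B s P.tail) ∧
      ((Bᶜ.Adj y s ∧ shortCut B s P = shortCutPath B s P.tail ++ [s]) ∨
        shortCut B s P = shortCutPath B s P.tail ++ (shortCutPath B s P.tail).reverse.tail) := by
  obtain ⟨l, rfl⟩ := List.head?_eq_some_iff.1 hs
  obtain ⟨y, hy⟩ := shortCutPath_isWalk (B := B) hnd
  refine ⟨y, hy, ?_⟩
  have hlast : (shortCutPath B s l).getLastD s = y := by
    rw [List.getLastD_eq_getLast?, hy.2.1]; rfl
  by_cases h : Bᶜ.Adj ((shortCutPath B s l).getLastD s) s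
  · exact .inl ⟨hlast ▸ h, if_pos h⟩
  · exact .inr (if_neg h)

lemma shortCut_isWalk {s : V} {P : List V} (hs : P.head? = some s) (hnd : P.Nodup) :
    IsWalk Bᶜ s s (shortCut B s P) := by
  obtain ⟨y, hy, ⟨h, he⟩ | he⟩ := shortCut_cases (B := B) hs hnd <;> rw [he]
  · exact hy.append (isWalk_cons_cons.2 ⟨rfl, h, isWalk_singleton.2 ⟨rfl, rfl⟩⟩)
  · exact hy.append hy.reverse

lemma mem_shortCut {s v : V} {P : List V} (hv : v ∈ shortCutPath B s P.tail) :
    v ∈ shortCut B s P := by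
  simp only [shortCut]
  split_ifs <;> exact List.mem_append_left _ hv

lemma walkCost_shortCut_le [PseudoMetricSpace V] {s : V} {P : List V} (hs : P.head? = some s)
    (hnd : P.Nodup) : walkCost (shortCut B s P) ≤ 2 * walkCost P := by
  obtain ⟨y, hy, hcases⟩ := shortCut_cases (B := B) hs hnd
  have hle : walkCost (shortCutPath B s P.tail) ≤ walkCost P := by
    have h := shortCutPath_sublist B s P.tail
    rw [List.cons_head?_tail hs] at h
    exact walkCost_le_of_sublist h
  rcases hcases with ⟨h, he⟩ | he <;> rw [he]
  · have h1 := hy.walkCost_append (isWalk_cons_cons.2 ⟨rfl, h, isWalk_singleton.2 ⟨rfl, rfl⟩⟩)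
    have h2 := dist_le_walkCost hy.1 hy.2.1
    simp only [List.tail_cons, walkCost_cons_cons, walkCost_singleton, dist_comm y s] at h1
    linarith
  · rw [hy.walkCost_append hy.reverse, walkCost_reverse]
    linarith

end ShortCut

section Competitive

variable {V : Type*} [PseudoMetricSpace V] {s : V}

lemma CompressAndExplore.isTour {B : SimpleGraph V} {P w : List V} (hs : P.head? = some s)
    (hnd : P.Nodup) (h : CompressAndExplore NearestNeighborRoute B s P w) : IsTour B s w := by
  obtain ⟨q, hq, rfl⟩ := h
  have h1 := shortCut_isWalk (B := B) hs hnd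
  have h2 := NearestNeighbor.isWalk compress_isWalk hq
  refine ⟨h1.append h2, fun v => ?_⟩
  by_cases hv : v ∈ shortCutPath B s P.tail
  · exact List.mem_append_left _ (mem_shortCut hv)
  · by_cases hvs : v = s
    · exact List.mem_append_left _ (hvs ▸ h1.head_mem)
    · have h3 := NearestNeighbor.mem compress_isWalk hq (v := v) ⟨.inr hv, hvs⟩
      rw [h2.eq_cons, List.mem_cons] at h3
      exact List.mem_append_right _ (h3.resolve_left hvs)

variable [Finite V]

lemma CompressAndExplore.walkCost_le {B : SimpleGraph V} {P w t : List V} {k : ℕ}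
    (hP : IsChristofidesTour s P) (h : CompressAndExplore NearestNeighborRoute B s P w)
    (ht : IsTour B s t) (hk : B.edgeSet.ncard ≤ k) :
    walkCost w ≤ (7 + 2 * Real.log k) * walkCost t := by
  obtain ⟨q, hq, rfl⟩ := h
  have hPt := hP.walkCost_le ht.1 ht.2
  obtain ⟨_, _, _, -, -, -, -, hs, hnd, hall⟩ := hP
  rw [(shortCut_isWalk hs hnd).walkCost_append (NearestNeighbor.isWalk compress_isWalk hq)]
  have h1 := walkCost_shortCut_le (B := B) hs hnd
  have h2 := hq.walkCost_le (.inl rfl) ht ((ncard_remaining_le hs hall).trans hk)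
  linarith

theorem IsCNN.isCompetitive {A : OnlineAlgorithm V} (hA : IsCNN s A) {k : ℕ} (hk : 2 ≤ k) :
    IsCompetitive s A k (13 * Real.log k) := by
  obtain ⟨P, hP, hA⟩ := hA
  intro B hB hBk
  obtain ⟨w, hout, hw⟩ := hA B hB
  have hlog : Real.log 2 ≤ Real.log k := Real.log_le_log (by norm_num) (by exact_mod_cast hk)
  -- `7 ≤ 11 * log 2` absorbs the additive constant into the logarithm.
  have h2 : (0.6931471803 : ℝ) < Real.log 2 := Real.log_two_gt_d9
  have hpos : 0 < 13 * Real.log k := by linarith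
  have htour : IsTour B s w := by
    obtain ⟨_, _, _, -, -, -, -, hs, hnd, -⟩ := hP
    exact hw.isTour hs hnd
  refine ⟨w, hout, htour, ?_⟩
  rw [← div_le_iff₀' hpos]
  refine le_csInf ⟨_, w, htour, rfl⟩ ?_
  rintro _ ⟨t, ht, rfl⟩
  rw [div_le_iff₀' hpos]
  refine (hw.walkCost_le hP ht hBk).trans ?_
  exact mul_le_mul_of_nonneg_right (by linarith) (walkCost_nonneg t)

end Competitive

/-! ### Implementation as an online algorithm -/

section Coherence

variable {V : Type*} {B B' : SimpleGraph V} {K K' : Set V}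

/-- The edges at the vertices in `K` do not tell the sets of blocked edges `B` and `B'` apart. -/
def Agree (B B' : SimpleGraph V) (K : Set V) : Prop :=
  ∀ v ∈ K, B.neighborSet v = B'.neighborSet v

lemma Agree.mono (h : Agree B B' K') (hK : K ⊆ K') : Agree B B' K := fun v hv => h v (hK hv)

lemma Agree.symm (h : Agree B B' K) : Agree B' B K := fun v hv => (h v hv).symm

lemma Agree.adj_iff (h : Agree B B' K) {x y : V} (hx : x ∈ K) : B.Adj x y ↔ B'.Adj x y := by
  have := congrArg (y ∈ ·) (h x hx)
  simpa using this

lemma Agree.adj_iff_right (h : Agree B B' K) {x y : V} (hy : y ∈ K) :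
    B.Adj x y ↔ B'.Adj x y := by
  rw [B.adj_comm, B'.adj_comm]
  exact h.adj_iff hy

/-- The continuation `q` under the blocked edges `B` and the continuation `q'` under the blocked
edges `B'`, of a walk on which the vertices in `K` have been seen, take the same next step (or both
stop) as long as what has been seen does not tell `B` and `B'` apart. -/
def Coherent (B B' : SimpleGraph V) (K : Set V) (q q' : List V) : Prop :=
  ∀ i, Agree B B' (K ∪ {v | v ∈ q.take i}) → q.take (i + 1) = q'.take (i + 1)

lemma Coherent.refl (q : List V) : Coherent B B' K q q := fun _ _ => rfl

lemma Coherent.of_agree {q q' : List V} (h : Agree B B' K → Coherent B B' K q q') :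
    Coherent B B' K q q' :=
  fun i hi => h (hi.mono Set.subset_union_left) i hi

lemma Coherent.mono {q q' : List V} (h : Coherent B B' K q q') (hK : K ⊆ K') :
    Coherent B B' K' q q' :=
  fun i hi => h i (hi.mono (Set.union_subset_union_left _ hK))

lemma Coherent.eq {q q' : List V} (h : Coherent B B' K q q')
    (ha : Agree B B' (K ∪ {v | v ∈ q})) : q = q' := by
  have h1 := h q.length (by rwa [List.take_length])
  rw [List.take_of_length_le (by omega)] at h1
  have h2 := congrArg List.length h1
  rw [List.length_take] at h2
  rwa [List.take_of_length_le (by omega)] at h1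

lemma Coherent.append {a a' b b' : List V} (ha : Coherent B B' K a a')
    (hb : Agree B B' (K ∪ {v | v ∈ a}) → Coherent B B' (K ∪ {v | v ∈ a}) b b') :
    Coherent B B' K (a ++ b) (a' ++ b') := by
  intro i hi
  rcases lt_or_ge i a.length with hlt | hge
  · rw [List.take_append_of_le_length hlt.le] at hi
    have h1 := ha i hi
    have h2 := congrArg List.length h1
    simp only [List.length_take] at h2
    rw [List.take_append_of_le_length (by omega), List.take_append_of_le_length (by omega), h1]
  · obtain ⟨j, rfl⟩ := Nat.exists_eq_add_of_le hge
    have hset : K ∪ {v | v ∈ (a ++ b).take (a.length + j)} =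
        (K ∪ {v | v ∈ a}) ∪ {v | v ∈ b.take j} := by
      rw [List.take_length_add_append]
      ext v; simp [or_assoc]
    rw [hset] at hi
    have h1 : Agree B B' (K ∪ {v | v ∈ a}) := hi.mono Set.subset_union_left
    obtain rfl := ha.eq h1
    rw [add_assoc, List.take_length_add_append, List.take_length_add_append, hb h1 j hi]

/-- Walks whose steps are determined by what has been seen are the walks of an online algorithm. -/
lemma exists_outputs {ι : Type*} (G : ι → SimpleGraph V) (s : V) (f : ι → List V)
    (hs : ∀ b, (f b).head? = some s)
    (hf : ∀ b b', Coherent (G b) (G b') {s} (f b).tail (f b').tail) :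
    ∃ A : OnlineAlgorithm V, ∀ b, A.Outputs (G b) s (f b) := by
  -- Having seen `h`, the algorithm takes the next step of any of the walks that start with `h`.
  let Q : List (V × Set V) → ι × ℕ → Prop := fun h bi =>
    0 < bi.2 ∧ bi.2 ≤ (f bi.1).length ∧ history (G bi.1) ((f bi.1).take bi.2) = h
  refine ⟨fun h => if hex : ∃ bi, Q h bi then (f hex.choose.1)[hex.choose.2]? else none,
    fun b => ⟨hs b, fun i hi hilen => ?_⟩⟩
  have hex : ∃ bi, Q (history (G b) ((f b).take i)) bi := ⟨(b, i), hi, hilen, rfl⟩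
  simp only [dif_pos hex]
  generalize hex.choose = bi, hex.choose_spec = hbi
  obtain ⟨b', i'⟩ := bi
  obtain ⟨hi', hilen', heq⟩ := hbi
  simp only at hi' hilen' heq ⊢
  have hii : i' = i := by
    have := congrArg List.length heq
    simpa [history, hilen, hilen'] using this
  subst hii
  have htake : (f b').take i' = (f b).take i' := by
    have := congrArg (List.map Prod.fst) heq
    simpa [history, Function.comp_def] using this
  have hagree : Agree (G b) (G b') {v | v ∈ (f b).take i'} := by
    intro v hv
    have h1 : (v, (G b).neighborSet v) ∈ history (G b') ((f b').take i') := by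
      rw [heq]; exact List.mem_map.2 ⟨v, hv, rfl⟩
    obtain ⟨u, -, hu⟩ := List.mem_map.1 h1
    simp only [Prod.mk.injEq] at hu
    rw [← hu.2, hu.1]
  obtain ⟨l, hl⟩ := List.head?_eq_some_iff.1 (hs b)
  obtain ⟨l', hl'⟩ := List.head?_eq_some_iff.1 (hs b')
  obtain ⟨j, rfl⟩ := Nat.exists_eq_add_of_le' hi'
  have hc := hf b b' j
  rw [hl, hl'] at *
  simp only [List.tail_cons] at hc
  have hc' := hc (hagree.mono (by intro v; simp))
  have h1 := congrArg (fun t : List V => t[j]?) hc'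
  simpa using h1.symm

end Coherence

section Online

variable {V : Type*} {B B' : SimpleGraph V}

lemma knownGraph_congr {U : Set V} (h : Agree B B' Uᶜ) : knownGraph B U = knownGraph B' U := by
  ext x y
  simp only [knownGraph, SimpleGraph.compl_adj]
  refine and_congr_left fun hxy => ?_
  rcases hxy with hx | hy
  · rw [h.adj_iff hx]
  · rw [h.adj_iff_right hy]

lemma shortCutPath_coherent {K : Set V} {v : V} {l : List V} (hv : v ∈ K) :
    Coherent B B' K (shortCutPath B v l).tail (shortCutPath B' v l).tail := by
  induction l generalizing v K with
  | nil => exact Coherent.refl _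
  | cons u l ih =>
    refine Coherent.of_agree fun hK => ?_
    simp only [shortCutPath]
    by_cases hB : B.Adj v u
    · rw [if_pos hB, if_pos ((hK.adj_iff hv).1 hB)]
      exact ih hv
    · rw [if_neg hB, if_neg (fun h => hB ((hK.adj_iff hv).2 h)), List.tail_cons, List.tail_cons,
        shortCutPath_eq_cons B, shortCutPath_eq_cons B']
      exact (Coherent.refl [u]).append fun _ => ih (.inr (by simp))

lemma shortCutPath_congr {s : V} {l : List V}
    (h : Agree B B' ({s} ∪ {v | v ∈ (shortCutPath B s l).tail})) :
    shortCutPath B s l = shortCutPath B' s l := by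
  rw [shortCutPath_eq_cons B, shortCutPath_eq_cons B',
    (shortCutPath_coherent (Set.mem_singleton s)).eq h]

lemma shortCut_coherent {s : V} {P : List V} :
    Coherent B B' {s} (shortCut B s P).tail (shortCut B' s P).tail := by
  have htail : ∀ B : SimpleGraph V, (shortCut B s P).tail = (shortCutPath B s P.tail).tail ++
      if B.Adj ((shortCutPath B s P.tail).getLastD s) s ∨
        (shortCutPath B s P.tail).getLastD s = s
      then (shortCutPath B s P.tail).reverse.tail else [s] := by
    intro B
    simp only [shortCut, SimpleGraph.compl_adj]
    rw [shortCutPath_eq_cons B]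
    split_ifs with h1 h2 h2
    · tauto
    · rfl
    · rfl
    · tauto
  rw [htail, htail]
  refine (shortCutPath_coherent (Set.mem_singleton s)).append fun h => ?_
  rw [← shortCutPath_congr h, h.adj_iff_right (y := s) (.inl rfl)]
  exact Coherent.refl _

lemma shortCut_eq_cons (B : SimpleGraph V) (s : V) (P : List V) :
    shortCut B s P = s :: (shortCut B s P).tail := by
  simp only [shortCut]
  rw [shortCutPath_eq_cons]
  split_ifs <;> simp

variable [PseudoMetricSpace V]

/-- The ways that are known to be possible depend only on what has been seen. -/
lemma travel_congr {U S : Set V} (h : Agree B B' (S ∪ Uᶜ)) :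
    Travel (compress B U) S = Travel (compress B' U) S := by
  have main : ∀ {B B' : SimpleGraph V}, Agree B B' (S ∪ Uᶜ) → ∀ {x y p},
      Travel (compress B U) S x y p → Travel (compress B' U) S x y p := by
    intro B B' h x y p ht
    induction ht with
    | nil x => exact .nil x
    | cons hx he _ ih =>
      refine .cons hx ?_ ih
      rw [compress, ← knownGraph_congr (h.mono Set.subset_union_right), ← h.adj_iff (.inl hx)]
      exact he
  ext x y p
  exact ⟨main h, main h.symm⟩

variable [Finite V]

/-- Nearest Neighbor can be carried out in such a way that every step depends only on what has been
seen: ties between the ways that are known to be possible are broken by a fixed choice. -/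
lemma exists_nearestNeighbor {U : Set V} {s : V} (hs : s ∈ U) {S : Set V} {c : V} (hSU : S ⊆ U)
    (hc : c ∈ S) : ∃ F : {B : SimpleGraph V // Bᶜ.Connected} → List V,
      (∀ B, NearestNeighbor (compress B.1 U) U s S c (F B)) ∧
      ∀ B B', Coherent B.1 B'.1 (S ∪ Uᶜ) (F B).tail (F B').tail := by
  induction hn : (U \ S).ncard generalizing S c with
  | zero =>
    have hUS : U ⊆ S := by
      rwa [Set.ncard_eq_zero, Set.sdiff_eq_empty] at hn
    let Q : (V → V → List V → Prop) → List V → Prop := fun T p =>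
      T c s p ∧ ∀ p', T c s p' → walkCost p ≤ walkCost p'
    have hQ : ∀ B : {B : SimpleGraph V // Bᶜ.Connected},
        Q (Travel (compress B.1 U) S) (Classical.epsilon (Q (Travel (compress B.1 U) S))) := by
      intro B
      refine Classical.epsilon_spec (p := Q (Travel (compress B.1 U) S)) ?_
      obtain ⟨r, hr⟩ := exists_isWalk_of_connected B.2 c s
      obtain ⟨z, q, h1, -, rfl | h3⟩ := exists_travel hSU hc hs hr
      · exact exists_min_walkCost id ⟨q, h1⟩
      · exact absurd (hUS h3.1) h3.2
    refine ⟨fun B => Classical.epsilon (Q (Travel (compress B.1 U) S)),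
      fun B => .done hUS (hQ B).1 (hQ B).2, fun B B' => Coherent.of_agree fun h => ?_⟩
    beta_reduce
    rw [travel_congr h]
    exact Coherent.refl _
  | succ n ih =>
    have hne : (U \ S).Nonempty := by
      rw [← Set.ncard_pos]; omega
    have hG : ∀ u, ∃ F : {B : SimpleGraph V // Bᶜ.Connected} → List V, u ∈ U \ S →
        (∀ B, NearestNeighbor (compress B.1 U) U s (insert u S) u (F B)) ∧
        ∀ B B', Coherent B.1 B'.1 (insert u S ∪ Uᶜ) (F B).tail (F B').tail := by
      intro u
      by_cases hu : u ∈ U \ S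
      · obtain ⟨F, hF⟩ := ih (Set.insert_subset hu.1 hSU) (Set.mem_insert u S) (by
          have := ncard_diff_insert hu
          omega)
        exact ⟨F, fun _ => hF⟩
      · exact ⟨fun _ => [], fun h => absurd h hu⟩
    choose G hG using hG
    let Q : (V → V → List V → Prop) → V × List V → Prop := fun T e =>
      (e.1 ∈ U \ S ∧ T c e.1 e.2) ∧ ∀ e' : V × List V, (e'.1 ∈ U \ S ∧ T c e'.1 e'.2) →
        walkCost e.2 ≤ walkCost e'.2
    have : Nonempty V := ⟨s⟩
    have hQ : ∀ B : {B : SimpleGraph V // Bᶜ.Connected},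
        Q (Travel (compress B.1 U) S) (Classical.epsilon (Q (Travel (compress B.1 U) S))) := by
      intro B
      refine Classical.epsilon_spec (p := Q (Travel (compress B.1 U) S)) ?_
      obtain ⟨y, hy⟩ := hne
      obtain ⟨r, hr⟩ := exists_isWalk_of_connected B.2 c y
      obtain ⟨z, q, h1, -, h3⟩ := exists_travel hSU hc hy.1 hr
      exact exists_min_walkCost (fun e : V × List V => e.2)
        ⟨(z, q), h3.elim (fun h => h ▸ hy) id, h1⟩
    have hwalk : ∀ B : {B : SimpleGraph V // Bᶜ.Connected}, _ := fun B =>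
      (hQ B).1.2.isWalk (G := B.1ᶜ) compress_isWalk
    refine ⟨fun B =>
      (Classical.epsilon (Q (Travel (compress B.1 U) S))).2 ++
        (G (Classical.epsilon (Q (Travel (compress B.1 U) S))).1 B).tail,
      fun B => .visit (hQ B).1.1 (hQ B).1.2 (fun u hu p hp => (hQ B).2 (u, p) ⟨hu, hp⟩)
        ((hG _ (hQ B).1.1).1 B), fun B B' => Coherent.of_agree fun h => ?_⟩
    have hQB := hQ B
    have hwB := hwalk B
    beta_reduce
    rw [← travel_congr h]
    generalize Classical.epsilon (Q (Travel (compress B.1 U) S)) = e at hQB hwB ⊢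
    -- The arrival at the new vertex `e.1` reveals its edges, as the next choice requires.
    have hcu : c ≠ e.1 := fun h => hQB.1.1.2 (h ▸ hc)
    rw [List.tail_append_of_ne_nil hwB.ne_nil, List.tail_append_of_ne_nil hwB.ne_nil]
    refine (Coherent.refl _).append fun _ => ((hG e.1 hQB.1.1).2 B B').mono ?_
    rintro v ((rfl | hv) | hv)
    · exact .inr (hwB.mem_tail_of_ne hcu)
    · exact .inl (.inl hv)
    · exact .inl (.inr hv)

theorem exists_isCNN (s : V) : ∃ A : OnlineAlgorithm V, IsCNN s A := by
  obtain ⟨P, hP⟩ := exists_isChristofidesTour s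
  choose F hF using fun U : {U : Set V // s ∈ U} =>
    exists_nearestNeighbor (s := s) U.2 (S := {s}) (by simpa using U.2) rfl
  let R : SimpleGraph V → {U : Set V // s ∈ U} := fun B => ⟨remaining B s P, .inl rfl⟩
  obtain ⟨A, hA⟩ := exists_outputs
    (fun B : {B : SimpleGraph V // Bᶜ.Connected} => B.1) s
    (fun B => shortCut B.1 s P ++ (F (R B.1) B).tail)
    (fun B => by rw [shortCut_eq_cons]; rfl) (fun B B' => by
      rw [shortCut_eq_cons B.1, shortCut_eq_cons B'.1]
      refine shortCut_coherent.append fun h => ?_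
      -- All vertices outside of the compressed graph have been seen after `ShortCut`, so the
      -- compressed graph is known up to the edges between unexplored vertices.
      have hsub : ∀ v ∈ shortCutPath B.1 s P.tail,
          v ∈ ({s} ∪ {v | v ∈ (shortCut B.1 s P).tail} : Set V) := by
        intro v hv
        have h1 := mem_shortCut hv
        rw [shortCut_eq_cons, List.mem_cons] at h1
        exact h1
      have hpath : shortCutPath B.1 s P.tail = shortCutPath B'.1 s P.tail := by
        refine shortCutPath_congr (h.mono ?_)
        rintro v (rfl | hv)
        · exact .inl rfl
        · exact hsub v (List.mem_of_mem_tail hv)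
      have hR : R B.1 = R B'.1 := by
        simp only [R, remaining, hpath]
      rw [← hR]
      refine ((hF (R B.1)).2 B B').mono ?_
      rintro v (rfl | hv)
      · exact .inl rfl
      · exact hsub v (by
          by_contra hv'
          exact hv (.inr hv')))
  exact ⟨A, P, hP, fun B hB => ⟨_, hA ⟨B, hB⟩, _, (hF (R B)).1 ⟨B, hB⟩, rfl⟩⟩

end Online

end CCTP

end

theorem mainTheorem2 :
    ∃ C : ℝ, 0 < C ∧
      ∀ (V : Type*) [Finite V] [PseudoMetricSpace V] (s : V),
        (∃ A : CCTP.OnlineAlgorithm V, CCTP.IsCNN s A) ∧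
        ∀ A : CCTP.OnlineAlgorithm V, CCTP.IsCNN s A →
          ∀ k : ℕ, 2 ≤ k → CCTP.IsCompetitive s A k (C * Real.log k) :=
  ⟨13, by norm_num, fun _ _ _ s =>
    ⟨CCTP.exists_isCNN s, fun _ hA _ hk => hA.isCompetitive hk⟩⟩
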